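/- Let $1<p<\infty$ and $0<s<1$. For a measurable $f:\mathbb{S}^1\to\mathbb{C}$ put $$\|f\|_{L^p}=\Bigl(\int_{-\pi}^{\pi}|f(e^{i\theta})|^p\,d\theta\Bigr)^{1/p},\qquad [f]=\Bigl(\iint_{(-\pi,\pi)^2}\frac{|f(e^{i\xi})-f(e^{i\sigma})|^p}{|e^{i\xi}-e^{i\sigma}|^{1+sp}}\,d\xi\,d\sigma\Bigr)^{1/p}.$$ Let $W^{s,p}(\mathbb{S}^1)=\{f\in L^p(\mathbb{S}^1;\mathbb{C}):[f]<\infty\}$, with norm $\|f\|_{W^{s,p}}=\|f\|_{L^p}+[f]$, and let $B^s_{p,p,+}(\mathbb{S}^1)=\{f\in W^{s,p}(\mathbb{S}^1):\hat f(k)=0\text{ for all }k<0\}$ with the same norm. Let $\mathcal{W}^{s,p}(\mathbb{D})$ be the space of analytic functions $u$ on the open unit disc $\mathbb{D}$ with $\sup_{0<r<1}[u_r]<\infty$, where $u_r(\xi)=u(r\xi)$ for $\xi\in\mathbb{S}^1$, with norm $\|u\|_{\mathcal{W}^{s,p}}=|u(0)|+\sup_{0<r<1}[u_r]$. Then $\mathcal{W}^{s,p}(\mathbb{D})$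 and $B^s_{p,p,+}(\mathbb{S}^1)$ are Banach spaces. Every $u\in\mathcal{W}^{s,p}(\mathbb{D})$ has a radial boundary trace $u^*(e^{i\theta})=\lim_{r\to1^-}u(re^{i\theta})$ for almost every $\theta$, and $u\mapsto u^*$ is an isomorphism of Banach spaces (a bounded linear bijection with bounded inverse) from $\mathcal{W}^{s,p}(\mathbb{D})$ onto $B^s_{p,p,+}(\mathbb{S}^1)$. Its inverse is the Poisson extension $g\mapsto P[g]$, $$P[g](z)=\frac1{2\pi}\int_{-\pi}^{\pi}\frac{1-|z|^2}{|e^{it}-z|^2}\,g(e^{it})\,dt\qquad(z\in\mathbb{D}).$$ Moreover, there is a constant $\kappa>0$ for which the fractional Poincaré inequality $$\|f-\bar f\|_{L^p}\le\kappa\,[f]\qquad\text{for all }f\in W^{s,p}(\mathbb{S}^1),\qquad \bar f=\frac1{2\pi}\int_{-\pi}^{\pi}f(e^{i\theta})\,d\theta,$$ holds, and for every such $\kappa$, with $C=\kappa+(2\pi)^{1/p}$, all $u\in\mathcal{W}^{s,p}(\mathbb{D})$ satisfy $$\|u\|_{\mathcal{W}^{s,p}}\le\|u^*\|_{W^{s,p}}\le(1+C)\,\|u\|_{\mathcal{W}^{s,p}}.$$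 -/

import Mathlib

open MeasureTheory Filter Topology Set
open scoped ENNReal Complex.UnitDisc

noncomputable section

namespace AnalyticBesov

/-- The unit circle in angular coordinates. `AddCircle.toCircle` is the map `θ ↦ e^{iθ}`, and
`volume` is the arc length measure `dθ`, of total mass `2π`. -/
abbrev Torus : Type := AddCircle (2 * Real.pi)

instance instFactTwoPi : Fact (0 < 2 * Real.pi) := ⟨Real.two_pi_pos⟩

instance instFactOneLe (p : ℝ) [hp : Fact (1 < p)] : Fact (1 ≤ ENNReal.ofReal p) :=
  ⟨by simpa using ENNReal.ofReal_le_ofReal hp.out.le⟩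

/-! ### The Gagliardo seminorm -/

/-- The Gagliardo seminorm
`[f] = (∬ |f(ξ) - f(σ)|^p / |e^{iξ} - e^{iσ}|^{1 + s p} dξ dσ)^{1/p}`, with values in `[0, ∞]`. -/
def gagliardo (s p : ℝ) (f : Torus → ℂ) : ℝ≥0∞ :=
  (∫⁻ z : Torus × Torus, ‖f z.1 - f z.2‖ₑ ^ p /
    ‖(AddCircle.toCircle z.1 : ℂ) - (AddCircle.toCircle z.2 : ℂ)‖ₑ ^ (1 + s * p)) ^ (1 / p)

lemma gagliardo_congr {s p : ℝ} {f g : Torus → ℂ} (h : f =ᵐ[volume] g) :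
    gagliardo s p f = gagliardo s p g := by
  unfold gagliardo
  congr 1
  refine lintegral_congr_ae ?_
  have h1 : ∀ᵐ z : Torus × Torus, f z.1 = g z.1 :=
    Measure.quasiMeasurePreserving_fst.ae h
  have h2 : ∀ᵐ z : Torus × Torus, f z.2 = g z.2 :=
    Measure.quasiMeasurePreserving_snd.ae h
  filter_upwards [h1, h2] with z hz1 hz2
  rw [hz1, hz2]

lemma gagliardo_zero {s p : ℝ} (hp : 1 < p) : gagliardo s p (0 : Torus → ℂ) = 0 := by
  have : 0 < p := by linarith
  simp [gagliardo, this]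

lemma gagliardo_smul {s p : ℝ} (hp : 1 < p) (c : ℂ) (f : Torus → ℂ) :
    gagliardo s p (c • f) = ‖c‖ₑ * gagliardo s p f := by
  have h0 : 0 < p := by linarith
  unfold gagliardo
  have : ∀ z : Torus × Torus, ‖(c • f) z.1 - (c • f) z.2‖ₑ ^ p /
      ‖(AddCircle.toCircle z.1 : ℂ) - (AddCircle.toCircle z.2 : ℂ)‖ₑ ^ (1 + s * p)
      = ‖c‖ₑ ^ p * (‖f z.1 - f z.2‖ₑ ^ p /
      ‖(AddCircle.toCircle z.1 : ℂ) - (AddCircle.toCircle z.2 : ℂ)‖ₑ ^ (1 + s * p)) := by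
    intro z
    rw [Pi.smul_apply, Pi.smul_apply, ← smul_sub, enorm_smul, ENNReal.mul_rpow_of_nonneg _ _ h0.le,
      mul_div_assoc]
  simp_rw [this]
  rw [lintegral_const_mul' _ _ (ENNReal.rpow_ne_top_of_nonneg h0.le enorm_ne_top),
    ENNReal.mul_rpow_of_nonneg _ _ (by positivity), ← ENNReal.rpow_mul, mul_one_div_cancel h0.ne',
    ENNReal.rpow_one]

lemma gagliardo_add_le {s p : ℝ} (hp : 1 < p) {f g : Torus → ℂ}
    (hf : AEStronglyMeasurable f volume) (hg : AEStronglyMeasurable g volume) :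
    gagliardo s p (f + g) ≤ gagliardo s p f + gagliardo s p g := by
  have h0 : 0 < p := by linarith
  let w : Torus × Torus → ℝ≥0∞ := fun z =>
    (‖(AddCircle.toCircle z.1 : ℂ) - (AddCircle.toCircle z.2 : ℂ)‖ₑ ^ (1 + s * p)) ^ (1 / p)
  have hcont : Continuous fun z : Torus × Torus =>
      (AddCircle.toCircle z.1 : ℂ) - (AddCircle.toCircle z.2 : ℂ) :=
    (continuous_subtype_val.comp (AddCircle.continuous_toCircle.comp continuous_fst)).sub
      (continuous_subtype_val.comp (AddCircle.continuous_toCircle.comp continuous_snd))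
  have hw : Measurable w := (hcont.measurable.enorm.pow_const _).pow_const _
  have hker : ∀ h : Torus → ℂ, gagliardo s p h =
      (∫⁻ z : Torus × Torus, (‖h z.1 - h z.2‖ₑ / w z) ^ p) ^ (1 / p) := by
    intro h
    unfold gagliardo
    congr 1
    refine lintegral_congr fun z => ?_
    rw [ENNReal.div_rpow_of_nonneg _ _ h0.le]
    simp only [w]
    rw [← ENNReal.rpow_mul _ (1 / p) p, one_div_mul_cancel h0.ne', ENNReal.rpow_one]
  have hmeas : ∀ h : Torus → ℂ, AEStronglyMeasurable h volume →
      AEMeasurable (fun z : Torus × Torus => ‖h z.1 - h z.2‖ₑ / w z) volume := by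
    intro h hh
    have h1 : AEStronglyMeasurable (fun z : Torus × Torus => h z.1 - h z.2) volume :=
      (hh.comp_quasiMeasurePreserving Measure.quasiMeasurePreserving_fst).sub
        (hh.comp_quasiMeasurePreserving Measure.quasiMeasurePreserving_snd)
    exact h1.enorm.div hw.aemeasurable
  rw [hker, hker, hker]
  refine le_trans ?_ (ENNReal.lintegral_Lp_add_le (hmeas f hf) (hmeas g hg) hp.le)
  refine ENNReal.rpow_le_rpow (lintegral_mono fun z => ?_) (by positivity)
  refine ENNReal.rpow_le_rpow ?_ h0.le
  simp only [Pi.add_apply]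
  rw [← ENNReal.add_div, add_sub_add_comm]
  gcongr
  exact enorm_add_le _ _

lemma gagliardo_eq_zero {s p : ℝ} (hp : 1 < p) {f : Torus → ℂ} (hf : Continuous f)
    (h : gagliardo s p f = 0) (ξ σ : Torus) : f ξ = f σ := by
  have h0 : 0 < p := by linarith
  unfold gagliardo at h
  rw [ENNReal.rpow_eq_zero_iff_of_pos (by positivity)] at h
  have hcont : Continuous fun z : Torus × Torus =>
      (AddCircle.toCircle z.1 : ℂ) - (AddCircle.toCircle z.2 : ℂ) :=
    (continuous_subtype_val.comp (AddCircle.continuous_toCircle.comp continuous_fst)).sub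
      (continuous_subtype_val.comp (AddCircle.continuous_toCircle.comp continuous_snd))
  have hc1 : Continuous fun z : Torus × Torus => f z.1 := hf.comp continuous_fst
  have hc2 : Continuous fun z : Torus × Torus => f z.2 := hf.comp continuous_snd
  have hmeas : Measurable fun z : Torus × Torus => ‖f z.1 - f z.2‖ₑ ^ p /
      ‖(AddCircle.toCircle z.1 : ℂ) - (AddCircle.toCircle z.2 : ℂ)‖ₑ ^ (1 + s * p) :=
    ((hc1.sub hc2).measurable.enorm.pow_const _).div (hcont.measurable.enorm.pow_const _)
  rw [lintegral_eq_zero_iff hmeas] at h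
  have hae : (fun z : Torus × Torus => f z.1) =ᵐ[volume.prod volume] fun z => f z.2 := by
    filter_upwards [h] with z hz
    by_cases hz12 : z.1 = z.2
    · rw [hz12]
    · simp only [Pi.zero_apply, ENNReal.div_eq_zero_iff] at hz
      rcases hz with hz | hz
      · rw [ENNReal.rpow_eq_zero_iff_of_pos h0, enorm_eq_zero, sub_eq_zero] at hz
        exact hz
      · exfalso
        have hne : (AddCircle.toCircle z.1 : ℂ) - (AddCircle.toCircle z.2 : ℂ) ≠ 0 := by
          rw [sub_ne_zero]
          intro he
          exact hz12 (AddCircle.injective_toCircle Real.two_pi_pos.ne' (Circle.ext he))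
        exact ENNReal.rpow_ne_top_of_ne_zero (enorm_ne_zero.2 hne) enorm_ne_top hz
  exact congrFun ((hc1.ae_eq_iff_eq _ hc2).1 hae) (ξ, σ)

/-! ### The fractional Sobolev space of the circle and its analytic subspace -/

/-- The (classes of) functions `f ∈ L^p(𝕊¹)` with `[f] < ∞`. -/
def fracSobolevSubmodule (s p : ℝ) [hp : Fact (1 < p)] :
    Submodule ℂ (Lp ℂ (ENNReal.ofReal p) (volume : Measure Torus)) where
  carrier := {f | gagliardo s p f < ⊤}
  zero_mem' := by
    rw [mem_ofPred_eq, gagliardo_congr (Lp.coeFn_zero _ _ _), gagliardo_zero hp.out]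
    exact ENNReal.zero_lt_top
  add_mem' := by
    intro f g hf hg
    rw [mem_ofPred_eq, gagliardo_congr (Lp.coeFn_add f g)]
    exact (gagliardo_add_le hp.out (Lp.aestronglyMeasurable f)
      (Lp.aestronglyMeasurable g)).trans_lt (ENNReal.add_lt_top.2 ⟨hf, hg⟩)
  smul_mem' := by
    intro c f hf
    rw [mem_ofPred_eq, gagliardo_congr (Lp.coeFn_smul c f), gagliardo_smul hp.out]
    exact ENNReal.mul_lt_top enorm_lt_top hf

/-- The fractional Sobolev space `W^{s,p}(𝕊¹) = B^s_{p,p}(𝕊¹)` of complex-valued functions. It is a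
type of its own because its norm is not the one inherited from `L^p`. -/
def FracSobolev (s p : ℝ) [Fact (1 < p)] : Type := fracSobolevSubmodule s p

namespace FracSobolev

variable {s p : ℝ} [hp : Fact (1 < p)]

instance instAddCommGroup : AddCommGroup (FracSobolev s p) :=
  inferInstanceAs (AddCommGroup (fracSobolevSubmodule s p))

instance instModule : Module ℂ (FracSobolev s p) :=
  inferInstanceAs (Module ℂ (fracSobolevSubmodule s p))

/-- The underlying element of `L^p(𝕊¹)`. -/
def toLp : FracSobolev s p →ₗ[ℂ] Lp ℂ (ENNReal.ofReal p) (volume : Measure Torus) :=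
  (fracSobolevSubmodule s p).subtype

instance instCoeFun : CoeFun (FracSobolev s p) (fun _ => Torus → ℂ) := ⟨fun f => toLp f⟩

lemma gagliardo_lt_top (f : FracSobolev s p) : gagliardo s p f < ⊤ := f.2

/-- `‖f‖ = ‖f‖_{L^p} + [f]`. -/
instance instNorm : Norm (FracSobolev s p) := ⟨fun f => ‖toLp f‖ + (gagliardo s p f).toReal⟩

lemma norm_def (f : FracSobolev s p) : ‖f‖ = ‖toLp f‖ + (gagliardo s p f).toReal := rfl

lemma normCore : NormedSpace.Core ℂ (FracSobolev s p) where
  norm_nonneg f := by rw [norm_def]; positivity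
  norm_smul c f := by
    rw [norm_def, norm_def, map_smul, norm_smul, gagliardo_congr (Lp.coeFn_smul c (toLp f)),
      gagliardo_smul hp.out, ENNReal.toReal_mul, toReal_enorm, mul_add]
  norm_triangle f g := by
    rw [norm_def, norm_def, norm_def, map_add, gagliardo_congr (Lp.coeFn_add (toLp f) (toLp g))]
    have h1 := gagliardo_add_le (s := s) hp.out (Lp.aestronglyMeasurable (toLp f))
      (Lp.aestronglyMeasurable (toLp g))
    have h2 := ENNReal.toReal_mono
      (ENNReal.add_lt_top.2 ⟨gagliardo_lt_top f, gagliardo_lt_top g⟩).ne h1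
    rw [ENNReal.toReal_add (gagliardo_lt_top f).ne (gagliardo_lt_top g).ne] at h2
    linarith [norm_add_le (toLp f) (toLp g)]
  norm_eq_zero_iff f := by
    constructor
    · intro h
      rw [norm_def] at h
      have h1 : ‖toLp f‖ = 0 := by
        linarith [norm_nonneg (toLp f), ENNReal.toReal_nonneg (a := gagliardo s p f)]
      exact Subtype.ext (norm_eq_zero.1 h1)
    · rintro rfl
      rw [norm_def, map_zero, norm_zero, gagliardo_congr (Lp.coeFn_zero _ _ _),
        gagliardo_zero hp.out]
      simp

instance instNormedAddCommGroup : NormedAddCommGroup (FracSobolev s p) :=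
  NormedAddCommGroup.ofCore normCore

instance instNormedSpace : NormedSpace ℂ (FracSobolev s p) := NormedSpace.ofCore normCore

lemma integrable (f : FracSobolev s p) : Integrable f AddCircle.haarAddCircle :=
  ((memLp_haarAddCircle_iff).2 (Lp.memLp (toLp f))).integrable Fact.out

end FracSobolev

lemma fourierCoeff_congr_ae {f g : Torus → ℂ} (h : f =ᵐ[volume] g) :
    fourierCoeff f = fourierCoeff g := by
  have h' : f =ᵐ[AddCircle.haarAddCircle] g := by
    rw [AddCircle.volume_eq_smul_haarAddCircle] at h
    exact (Measure.ae_ennreal_smul_measure_iff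
      (ENNReal.ofReal_pos.2 Real.two_pi_pos).ne').1 h
  ext k
  refine integral_congr_ae ?_
  filter_upwards [h'] with t ht
  rw [ht]

/-- The analytic Besov space `B^s_{p,p,+}(𝕊¹)`: the functions in `W^{s,p}(𝕊¹)` whose Fourier
coefficients of negative index vanish, with the norm of `W^{s,p}(𝕊¹)`. -/
def analyticBesov (s p : ℝ) [Fact (1 < p)] : Submodule ℂ (FracSobolev s p) where
  carrier := {f | ∀ k : ℤ, k < 0 → fourierCoeff f k = 0}
  zero_mem' := by
    intro k _
    rw [map_zero, fourierCoeff_congr_ae (Lp.coeFn_zero ℂ (ENNReal.ofReal p) (volume : Measure Torus))]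
    simp [fourierCoeff]
  add_mem' := by
    intro f g hf hg k hk
    rw [map_add, fourierCoeff_congr_ae (Lp.coeFn_add (FracSobolev.toLp f) (FracSobolev.toLp g)),
      fourierCoeff.add f.integrable g.integrable, Pi.add_apply, hf k hk, hg k hk, add_zero]
  smul_mem' := by
    intro c f hf k hk
    rw [map_smul, fourierCoeff_congr_ae (Lp.coeFn_smul c (FracSobolev.toLp f)), fourierCoeff.const_smul,
      hf k hk, smul_zero]

/-- `κ` is a constant in the fractional Poincaré inequality: for all `f ∈ W^{s,p}(𝕊¹)`,
`‖f - f̄‖_{L^p} ≤ κ [f]`, where `f̄` is the mean value of `f`. -/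
def IsPoincareConst (s p : ℝ) [Fact (1 < p)] (κ : ℝ) : Prop :=
  0 < κ ∧ ∀ f : FracSobolev s p,
    eLpNorm (fun θ => f θ - (2 * Real.pi : ℂ)⁻¹ * ∫ t, f t) (ENNReal.ofReal p)
      (volume : Measure Torus) ≤ ENNReal.ofReal κ * gagliardo s p f

/-! ### The space of analytic functions on the disc -/

/-- Extension of a function on the open unit disc by zero. -/
def discExtend (u : 𝔻 → ℂ) : ℂ → ℂ := Function.extend Complex.UnitDisc.coe u 0

/-- `u` is analytic on the open unit disc. -/
def IsAnalyticOnDisc (u : 𝔻 → ℂ) : Prop := AnalyticOnNhd ℂ (discExtend u) (Metric.ball 0 1)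

/-- The radial restriction `u_r(e^{iθ}) = u(r e^{iθ})`, for `0 < r < 1`. -/
def slice (u : 𝔻 → ℂ) (r : ℝ) (θ : Torus) : ℂ := discExtend u (r * (AddCircle.toCircle θ : ℂ))

/-- `sup_{0 < r < 1} [u_r]`. -/
def supGagliardo (s p : ℝ) (u : 𝔻 → ℂ) : ℝ≥0∞ := ⨆ r ∈ Ioo (0 : ℝ) 1, gagliardo s p (slice u r)

lemma discExtend_coe (u : 𝔻 → ℂ) (z : 𝔻) : discExtend u z = u z :=
  Complex.UnitDisc.coe_injective.extend_apply _ _ _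

lemma discExtend_zero : discExtend 0 = 0 := by
  ext z
  by_cases h : ∃ w : 𝔻, (w : ℂ) = z
  · obtain ⟨w, rfl⟩ := h
    rw [discExtend_coe]; rfl
  · exact Function.extend_apply' _ _ _ h

lemma discExtend_add (u v : 𝔻 → ℂ) : discExtend (u + v) = discExtend u + discExtend v := by
  ext z
  by_cases h : ∃ w : 𝔻, (w : ℂ) = z
  · obtain ⟨w, rfl⟩ := h
    simp [discExtend_coe]
  · simp [discExtend, Function.extend_apply' _ _ _ h]

lemma discExtend_smul (c : ℂ) (u : 𝔻 → ℂ) : discExtend (c • u) = c • discExtend u := by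
  ext z
  by_cases h : ∃ w : 𝔻, (w : ℂ) = z
  · obtain ⟨w, rfl⟩ := h
    simp [discExtend_coe]
  · simp [discExtend, Function.extend_apply' _ _ _ h]

lemma slice_zero (r : ℝ) : slice 0 r = 0 := by
  ext θ; simp [slice, discExtend_zero]

lemma slice_add (u v : 𝔻 → ℂ) (r : ℝ) : slice (u + v) r = slice u r + slice v r := by
  ext θ; simp [slice, discExtend_add]

lemma slice_smul (c : ℂ) (u : 𝔻 → ℂ) (r : ℝ) : slice (c • u) r = c • slice u r := by
  ext θ; simp [slice, discExtend_smul]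

lemma IsAnalyticOnDisc.continuous_slice {u : 𝔻 → ℂ} (hu : IsAnalyticOnDisc u) {r : ℝ}
    (hr : r ∈ Ioo (0 : ℝ) 1) : Continuous (slice u r) := by
  have h1 : Continuous fun θ : Torus => (r : ℂ) * (AddCircle.toCircle θ : ℂ) :=
    continuous_const.mul (continuous_subtype_val.comp AddCircle.continuous_toCircle)
  refine hu.continuousOn.comp_continuous h1 fun θ => ?_
  rw [mem_ball_zero_iff, norm_mul, Circle.norm_coe, mul_one, Complex.norm_real, Real.norm_eq_abs,
    abs_of_pos hr.1]
  exact hr.2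

lemma supGagliardo_zero {s p : ℝ} (hp : 1 < p) : supGagliardo s p 0 = 0 := by
  simp [supGagliardo, slice_zero, gagliardo_zero hp]

lemma supGagliardo_smul {s p : ℝ} (hp : 1 < p) (c : ℂ) (u : 𝔻 → ℂ) :
    supGagliardo s p (c • u) = ‖c‖ₑ * supGagliardo s p u := by
  simp [supGagliardo, slice_smul, gagliardo_smul hp, ENNReal.mul_iSup]

lemma supGagliardo_add_le {s p : ℝ} (hp : 1 < p) {u v : 𝔻 → ℂ} (hu : IsAnalyticOnDisc u)
    (hv : IsAnalyticOnDisc v) :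
    supGagliardo s p (u + v) ≤ supGagliardo s p u + supGagliardo s p v := by
  refine iSup₂_le fun r hr => ?_
  rw [slice_add]
  refine (gagliardo_add_le hp (hu.continuous_slice hr).aestronglyMeasurable
    (hv.continuous_slice hr).aestronglyMeasurable).trans ?_
  exact add_le_add (le_iSup₂ (f := fun r (_ : r ∈ Ioo (0 : ℝ) 1) => gagliardo s p (slice u r)) r hr)
    (le_iSup₂ (f := fun r (_ : r ∈ Ioo (0 : ℝ) 1) => gagliardo s p (slice v r)) r hr)

lemma eq_zero_of_supGagliardo {s p : ℝ} (hp : 1 < p) {u : 𝔻 → ℂ} (hu : IsAnalyticOnDisc u)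
    (h0 : u 0 = 0) (h : supGagliardo s p u = 0) : u = 0 := by
  have hz0 : discExtend u 0 = 0 := by
    have := discExtend_coe u 0
    rw [h0] at this
    exact this
  ext z
  by_cases hz : (z : ℂ) = 0
  · rw [← discExtend_coe u z, hz, hz0]; rfl
  set r : ℝ := ‖(z : ℂ)‖ with hr
  have hr1 : r ∈ Ioo (0 : ℝ) 1 := ⟨norm_pos_iff.2 hz, z.norm_lt_one⟩
  have hg : gagliardo s p (slice u r) = 0 := by
    simp only [supGagliardo, ENNReal.iSup_eq_zero] at h
    exact h r hr1
  have hconst : ∀ w ∈ Metric.sphere (0 : ℂ) |r|, discExtend u w = discExtend u z := by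
    have key : ∀ w : ℂ, ‖w‖ = r → ∃ θ : Torus, (r : ℂ) * (AddCircle.toCircle θ : ℂ) = w := by
      intro w hw
      refine ⟨((Complex.arg w : ℝ) : Torus), ?_⟩
      rw [AddCircle.toCircle_apply_mk, div_self Real.two_pi_pos.ne', one_mul, Circle.coe_exp, ← hw]
      exact Complex.norm_mul_exp_arg_mul_I w
    intro w hw
    obtain ⟨θ, hθ⟩ := key w (by simpa [abs_of_pos hr1.1] using hw)
    obtain ⟨σ, hσ⟩ := key z hr.symm
    have := gagliardo_eq_zero hp (hu.continuous_slice hr1) hg θ σ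
    simpa only [slice, hθ, hσ] using this
  have hdiff : DiffContOnCl ℂ (discExtend u) (Metric.ball 0 |r|) := by
    have hsub : Metric.closedBall (0 : ℂ) |r| ⊆ Metric.ball 0 1 :=
      Metric.closedBall_subset_ball (by rw [abs_of_pos hr1.1]; exact hr1.2)
    exact (hu.differentiableOn.mono (Metric.closure_ball_subset_closedBall.trans hsub)).diffContOnCl
  have hmean := hdiff.circleAverage
  rw [Real.circleAverage_congr_sphere (f₂ := fun _ => discExtend u z) hconst,
    Real.circleAverage_const, hz0] at hmean
  rw [← discExtend_coe u z, hmean]; rfl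

/-- The analytic functions `u` on the disc with `sup_{0 < r < 1} [u_r] < ∞`. -/
def discSobolevSubmodule (s p : ℝ) [hp : Fact (1 < p)] : Submodule ℂ (𝔻 → ℂ) where
  carrier := {u | IsAnalyticOnDisc u ∧ supGagliardo s p u < ⊤}
  zero_mem' := by
    refine ⟨?_, ?_⟩
    · rw [IsAnalyticOnDisc, discExtend_zero]
      exact analyticOnNhd_const
    · rw [supGagliardo_zero hp.out]
      exact ENNReal.zero_lt_top
  add_mem' := by
    rintro u v ⟨hu, hu'⟩ ⟨hv, hv'⟩
    refine ⟨?_, (supGagliardo_add_le hp.out hu hv).trans_lt (ENNReal.add_lt_top.2 ⟨hu', hv'⟩)⟩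
    rw [IsAnalyticOnDisc, discExtend_add]
    exact AnalyticOnNhd.add hu hv
  smul_mem' := by
    rintro c u ⟨hu, hu'⟩
    refine ⟨?_, ?_⟩
    · rw [IsAnalyticOnDisc, discExtend_smul]
      exact AnalyticOnNhd.const_smul hu
    · rw [supGagliardo_smul hp.out]
      exact ENNReal.mul_lt_top enorm_lt_top hu'

/-- The space `𝒲^{s,p}(𝔻)`. -/
def DiscSobolev (s p : ℝ) [Fact (1 < p)] : Type := discSobolevSubmodule s p

namespace DiscSobolev

variable {s p : ℝ} [hp : Fact (1 < p)]

instance instAddCommGroup : AddCommGroup (DiscSobolev s p) :=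
  inferInstanceAs (AddCommGroup (discSobolevSubmodule s p))

instance instModule : Module ℂ (DiscSobolev s p) :=
  inferInstanceAs (Module ℂ (discSobolevSubmodule s p))

/-- The underlying function on the disc. -/
def toFun : DiscSobolev s p →ₗ[ℂ] (𝔻 → ℂ) := (discSobolevSubmodule s p).subtype

instance instCoeFun : CoeFun (DiscSobolev s p) (fun _ => 𝔻 → ℂ) := ⟨fun u => toFun u⟩

lemma isAnalyticOnDisc (u : DiscSobolev s p) : IsAnalyticOnDisc u := u.2.1

lemma supGagliardo_lt_top (u : DiscSobolev s p) : supGagliardo s p u < ⊤ := u.2.2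

/-- `‖u‖ = |u(0)| + sup_{0 < r < 1} [u_r]`. -/
instance instNorm : Norm (DiscSobolev s p) := ⟨fun u => ‖u 0‖ + (supGagliardo s p u).toReal⟩

lemma norm_def (u : DiscSobolev s p) : ‖u‖ = ‖u 0‖ + (supGagliardo s p u).toReal := rfl

lemma normCore : NormedSpace.Core ℂ (DiscSobolev s p) where
  norm_nonneg u := by rw [norm_def]; positivity
  norm_smul c u := by
    rw [norm_def, norm_def, map_smul, Pi.smul_apply, norm_smul, supGagliardo_smul hp.out,
      ENNReal.toReal_mul, toReal_enorm, mul_add]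
  norm_triangle u v := by
    rw [norm_def, norm_def, norm_def, map_add, Pi.add_apply]
    have h2 := ENNReal.toReal_mono
      (ENNReal.add_lt_top.2 ⟨supGagliardo_lt_top u, supGagliardo_lt_top v⟩).ne
      (supGagliardo_add_le hp.out u.isAnalyticOnDisc v.isAnalyticOnDisc)
    rw [ENNReal.toReal_add (supGagliardo_lt_top u).ne (supGagliardo_lt_top v).ne] at h2
    linarith [norm_add_le (u 0) (v 0)]
  norm_eq_zero_iff u := by
    constructor
    · intro h
      rw [norm_def] at h
      have h1 : ‖u 0‖ = 0 := by
        linarith [norm_nonneg (u 0), ENNReal.toReal_nonneg (a := supGagliardo s p u)]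
      have h2 : (supGagliardo s p u).toReal = 0 := by linarith
      rw [ENNReal.toReal_eq_zero_iff, or_iff_left (supGagliardo_lt_top u).ne] at h2
      exact Subtype.ext (eq_zero_of_supGagliardo hp.out u.isAnalyticOnDisc (norm_eq_zero.1 h1) h2)
    · rintro rfl
      rw [norm_def, map_zero, supGagliardo_zero hp.out]
      simp

instance instNormedAddCommGroup : NormedAddCommGroup (DiscSobolev s p) :=
  NormedAddCommGroup.ofCore normCore

instance instNormedSpace : NormedSpace ℂ (DiscSobolev s p) := NormedSpace.ofCore normCore

end DiscSobolev

/-! ### Boundary values -/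

/-- `f` is the radial boundary trace of `u`: `u(r e^{iθ}) → f(e^{iθ})` as `r → 1⁻`, for almost
every `θ`. -/
def IsTrace (u : 𝔻 → ℂ) (f : Torus → ℂ) : Prop :=
  ∀ᵐ θ : Torus, Tendsto (fun r : ℝ => slice u r θ) (𝓝[<] 1) (𝓝 (f θ))

/-- The Poisson extension
`P[g](z) = (1 / 2π) ∫ (1 - |z|²) / |e^{it} - z|² g(e^{it}) dt` of a function on the circle. For
`z = r e^{iθ}` the kernel is `P_r(θ - t) = (1 - r²) / (1 - 2 r cos(θ - t) + r²)`. -/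
def poissonExtension (g : Torus → ℂ) (z : 𝔻) : ℂ :=
  (2 * Real.pi : ℂ)⁻¹ * ∫ t : Torus, (poissonKernel 0 (z : ℂ) (AddCircle.toCircle t : ℂ) : ℂ) * g t

end AnalyticBesov

end

/-!
The measures `poissonMeasure r`, with the Poisson kernel of the point `r` as density against the
normalised arc length, are probability measures, and `poissonAverage r g`, the mean of the
translates of `g` against `poissonMeasure r`, is the restriction of the Poisson extension of `g` to
the circle of radius `r`. Everything rests on three facts.

* The averages approximate the identity at a rate controlled by the Gagliardo seminorm. The kernel
  satisfies `K_r(t) |e^{it} - 1|^{1 + sp} ≤ kernelConst s p r`, which tends to `0` as `r → 1⁻`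
  (`poissonKernel_mul_rpow_le`). By Jensen's inequality `|P_r g(θ) - g(θ)|^p` is at most
  `kernelConst s p r` times the inner integral of the Gagliardo seminorm at `θ`
  (`enorm_poissonAverage_sub_rpow_le`). At every `θ` where this integral is finite the radial limit
  exists, with no maximal function involved. Integrating over `θ` gives
  `‖P_r g - g‖_{L^p} ≤ (kernelConst s p r)^{1/p} [g]`, whose case `r = 0` is the fractional Poincaré
  inequality, `P_0 g` being the mean value of `g`.
* The averages do not increase the seminorm (`gagliardo_poissonAverage_le`):
  they are means of translates.
* The seminorm is lower semicontinuous under almost everywhere convergence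
  (`gagliardo_le_liminf`), by Fatou's lemma.

If the Fourier coefficients of negative index of `g` vanish, the antiholomorphic half of the kernel
integrates to zero and the Poisson extension is a power series (`hasSum_poissonExtension`). So the
Poisson extension maps the analytic Besov space into `𝒲^{s,p}(𝔻)` without increasing the norm, and
it is injective because its radial limits return `g`.

For surjectivity, take `u` in `𝒲^{s,p}(𝔻)`. The restriction of `u` to a circle is a Poisson average
of its restriction to any larger circle (`IsAnalyticOnDisc.slice_mul`). As these restrictions have
bounded seminorm, the approximation estimate makes them Cauchy in `L^p` as `r → 1⁻`. Their limit has
finite seminorm by lower semicontinuity and inherits the vanishing Fourier coefficients, and its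
Poisson extension is `u` (`poissonMap_surjective`). No weak compactness is needed.

The trace is the inverse of this bijection. The lower bound for its norm is the contractivity of the
Poisson extension. The upper bound combines `[g] ≤ sup_r [P_r g]`, again lower semicontinuity, with
the Poincaré inequality and `P[g](0) = ḡ`. The analytic Besov space is complete by the usual
Fatou argument, and the isomorphism transfers completeness to `𝒲^{s,p}(𝔻)`.
-/

noncomputable section

namespace AnalyticBesov

/-! ### The Poisson kernel as a probability measure -/

lemma continuous_coe_toCircle : Continuous fun t : Torus => (AddCircle.toCircle t : ℂ) :=
  continuous_subtype_val.comp AddCircle.continuous_toCircle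

lemma haarAddCircle_le_volume :
    (AddCircle.haarAddCircle : Measure Torus) ≤ (volume : Measure Torus) := by
  rw [AddCircle.volume_eq_smul_haarAddCircle]
  have h : (1 : ℝ≥0∞) ≤ ENNReal.ofReal (2 * Real.pi) := by
    rw [ENNReal.one_le_ofReal]
    linarith [Real.pi_gt_three]
  intro A
  rw [Measure.smul_apply, smul_eq_mul]
  exact le_mul_of_one_le_left zero_le h

lemma two_pi_inv_mul_integral (f : Torus → ℂ) :
    (2 * Real.pi : ℂ)⁻¹ * ∫ t, f t = ∫ t, f t ∂AddCircle.haarAddCircle := by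
  rw [AddCircle.integral_haarAddCircle, Complex.real_smul]
  push_cast
  rfl

lemma circleAverage_eq_integral_haar (f : ℂ → ℂ) :
    Real.circleAverage f 0 1
      = ∫ t : Torus, f (AddCircle.toCircle t : ℂ) ∂AddCircle.haarAddCircle := by
  rw [Real.circleAverage_def, AddCircle.integral_haarAddCircle,
    ← AddCircle.intervalIntegral_preimage (2 * Real.pi) 0, zero_add]
  congr 1
  refine intervalIntegral.integral_congr fun x _ => ?_
  simp only [circleMap, AddCircle.toCircle_apply_mk, div_self Real.two_pi_pos.ne', one_mul,
    Circle.coe_exp]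
  simp

lemma norm_toCircle_sub_pos {z : ℂ} (hz : ‖z‖ < 1) (t : Torus) :
    0 < ‖(AddCircle.toCircle t : ℂ) - z‖ := by
  rw [norm_pos_iff, sub_ne_zero]
  rintro rfl
  simp [Circle.norm_coe] at hz

lemma continuous_poissonKernel_toCircle {z : ℂ} (hz : ‖z‖ < 1) :
    Continuous fun t : Torus => poissonKernel 0 z (AddCircle.toCircle t : ℂ) := by
  simp only [poissonKernel_def, sub_zero]
  have h := continuous_coe_toCircle
  exact (((h.norm.pow 2).sub continuous_const)).div ((h.sub continuous_const).norm.pow 2)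
    fun t => pow_ne_zero 2 (norm_toCircle_sub_pos hz t).ne'

lemma poissonKernel_toCircle_nonneg {z : ℂ} (hz : ‖z‖ < 1) (t : Torus) :
    0 ≤ poissonKernel 0 z (AddCircle.toCircle t : ℂ) := by
  simp only [poissonKernel_def, sub_zero, Circle.norm_coe]
  have := norm_nonneg z
  exact div_nonneg (by nlinarith) (by positivity)

/-- Rotation invariance: the kernel depends only on the angle between the two points. -/
lemma poissonKernel_rotate (r : ℝ) (t θ : Torus) :
    poissonKernel 0 (r * (AddCircle.toCircle θ : ℂ)) (AddCircle.toCircle (t + θ) : ℂ)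
      = poissonKernel 0 r (AddCircle.toCircle t : ℂ) := by
  simp only [poissonKernel_def, sub_zero, Circle.norm_coe, AddCircle.toCircle_add, Circle.coe_mul,
    ← sub_mul, norm_mul, mul_one]

/-- The probability measure on the circle whose density with respect to the normalised arc length
is the Poisson kernel of the point `r`. -/
def poissonMeasure (r : ℝ) : Measure Torus :=
  AddCircle.haarAddCircle.withDensity
    fun t => ENNReal.ofReal (poissonKernel 0 (r : ℂ) (AddCircle.toCircle t : ℂ))

/-- The mean of the translates of `g` against the Poisson kernel; its value at `θ` is the Poisson
extension of `g` at `r e^{iθ}`. -/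
def poissonAverage (r : ℝ) (g : Torus → ℂ) (θ : Torus) : ℂ := ∫ t, g (t + θ) ∂poissonMeasure r

lemma norm_ofReal_lt_one {r : ℝ} (hr : r ∈ Ico (0 : ℝ) 1) : ‖(r : ℂ)‖ < 1 := by
  rw [Complex.norm_real, Real.norm_eq_abs, abs_of_nonneg hr.1]
  exact hr.2

lemma lintegral_poissonMeasure {r : ℝ} (hr : r ∈ Ico (0 : ℝ) 1) (f : Torus → ℝ≥0∞) :
    ∫⁻ t, f t ∂poissonMeasure r = ∫⁻ t, ENNReal.ofReal
      (poissonKernel 0 (r : ℂ) (AddCircle.toCircle t : ℂ)) * f t ∂AddCircle.haarAddCircle := by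
  rw [poissonMeasure, lintegral_withDensity_eq_lintegral_mul_non_measurable]
  · rfl
  · exact (continuous_poissonKernel_toCircle (norm_ofReal_lt_one hr)).measurable.ennreal_ofReal
  · exact ae_of_all _ fun _ => ENNReal.ofReal_lt_top

lemma integral_poissonMeasure {r : ℝ} (hr : r ∈ Ico (0 : ℝ) 1) (f : Torus → ℂ) :
    ∫ t, f t ∂poissonMeasure r = ∫ t, (poissonKernel 0 (r : ℂ) (AddCircle.toCircle t : ℂ) : ℂ)
      * f t ∂AddCircle.haarAddCircle := by
  rw [poissonMeasure, integral_withDensity_eq_integral_toReal_smul]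
  · refine integral_congr_ae (ae_of_all _ fun t => ?_)
    simp only [ENNReal.toReal_ofReal (poissonKernel_toCircle_nonneg (norm_ofReal_lt_one hr) t),
      Complex.real_smul]
  · exact (continuous_poissonKernel_toCircle (norm_ofReal_lt_one hr)).measurable.ennreal_ofReal
  · exact ae_of_all _ fun _ => ENNReal.ofReal_lt_top

lemma integral_poissonKernel_mul {f : ℂ → ℂ} (hf : DiffContOnCl ℂ f (Metric.ball 0 1)) {z : ℂ}
    (hz : ‖z‖ < 1) :
    ∫ t : Torus, (poissonKernel 0 z (AddCircle.toCircle t : ℂ) : ℂ)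
      * f (AddCircle.toCircle t : ℂ) ∂AddCircle.haarAddCircle = f z := by
  rw [← hf.circleAverage_poissonKernel_smul (w := z) (by simpa using hz),
    circleAverage_eq_integral_haar]
  simp [Complex.real_smul]

lemma isProbabilityMeasure_poissonMeasure {r : ℝ} (hr : r ∈ Ico (0 : ℝ) 1) :
    IsProbabilityMeasure (poissonMeasure r) := by
  have hc := continuous_poissonKernel_toCircle (norm_ofReal_lt_one hr)
  have h1 := integral_poissonKernel_mul (f := fun _ => 1) diffContOnCl_const (norm_ofReal_lt_one hr)
  simp only [mul_one, integral_complex_ofReal] at h1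
  have hint : Integrable (fun t : Torus => poissonKernel 0 (r : ℂ) (AddCircle.toCircle t : ℂ))
      AddCircle.haarAddCircle := hc.integrable_of_hasCompactSupport (.of_compactSpace _)
  constructor
  rw [← lintegral_one, lintegral_poissonMeasure hr]
  simp only [mul_one]
  rw [← ofReal_integral_eq_lintegral_ofReal hint
    (ae_of_all _ fun t => poissonKernel_toCircle_nonneg (norm_ofReal_lt_one hr) t)]
  have : (∫ t : Torus, poissonKernel 0 (r : ℂ) (AddCircle.toCircle t : ℂ)
      ∂AddCircle.haarAddCircle) = 1 := by exact_mod_cast h1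
  rw [this, ENNReal.ofReal_one]

lemma poissonMeasure_absolutelyContinuous (r : ℝ) :
    poissonMeasure r ≪ (volume : Measure Torus) :=
  (withDensity_absolutelyContinuous _ _).trans haarAddCircle_le_volume.absolutelyContinuous

lemma exists_poissonKernel_toCircle_le {z : ℂ} (hz : ‖z‖ < 1) :
    ∃ C : ℝ, ∀ t : Torus, ‖(poissonKernel 0 z (AddCircle.toCircle t : ℂ) : ℂ)‖ ≤ C := by
  have hc := Complex.continuous_ofReal.comp (continuous_poissonKernel_toCircle hz)
  obtain ⟨C, hC⟩ := isCompact_univ.exists_bound_of_continuousOn hc.continuousOn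
  exact ⟨C, fun t => hC t (mem_univ t)⟩

lemma integrable_poissonKernel_mul {g : Torus → ℂ} {μ : Measure Torus} (hg : Integrable g μ)
    {z : ℂ} (hz : ‖z‖ < 1) :
    Integrable (fun t => (poissonKernel 0 z (AddCircle.toCircle t : ℂ) : ℂ) * g t) μ := by
  obtain ⟨C, hC⟩ := exists_poissonKernel_toCircle_le hz
  exact hg.bdd_mul (Complex.continuous_ofReal.comp
    (continuous_poissonKernel_toCircle hz)).aestronglyMeasurable (ae_of_all _ hC)

lemma integrable_translate_poissonMeasure {g : Torus → ℂ} (hg : Integrable g) {r : ℝ}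
    (hr : r ∈ Ico (0 : ℝ) 1) (θ : Torus) : Integrable (fun t => g (t + θ)) (poissonMeasure r) := by
  have h1 : Integrable (fun t => g (t + θ)) AddCircle.haarAddCircle :=
    (hg.comp_add_right θ).mono_measure haarAddCircle_le_volume
  rw [poissonMeasure, integrable_withDensity_iff_integrable_smul']
  · refine (integrable_poissonKernel_mul h1 (norm_ofReal_lt_one hr)).congr (ae_of_all _ fun t => ?_)
    simp only [ENNReal.toReal_ofReal (poissonKernel_toCircle_nonneg (norm_ofReal_lt_one hr) t),
      Complex.real_smul]
  · exact (continuous_poissonKernel_toCircle (norm_ofReal_lt_one hr)).measurable.ennreal_ofReal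
  · exact ae_of_all _ fun _ => ENNReal.ofReal_lt_top

lemma poissonExtension_eq (g : Torus → ℂ) (z : 𝔻) :
    poissonExtension g z = ∫ t, (poissonKernel 0 (z : ℂ) (AddCircle.toCircle t : ℂ) : ℂ) * g t
      ∂AddCircle.haarAddCircle := by
  rw [poissonExtension, two_pi_inv_mul_integral]

lemma slice_poissonExtension (g : Torus → ℂ) {r : ℝ} (hr : r ∈ Ico (0 : ℝ) 1) :
    slice (poissonExtension g) r = poissonAverage r g := by
  ext θ
  have hz : ‖(r : ℂ) * (AddCircle.toCircle θ : ℂ)‖ < 1 := by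
    rw [norm_mul, Circle.norm_coe, mul_one]
    exact norm_ofReal_lt_one hr
  rw [slice, ← Complex.UnitDisc.coe_mk _ hz, discExtend_coe, poissonExtension_eq,
    Complex.UnitDisc.coe_mk, poissonAverage, integral_poissonMeasure hr,
    ← integral_add_right_eq_self _ θ]
  simp only [poissonKernel_rotate]

/-- The Poisson formula for an analytic function on a concentric circle of radius `r < 1`. -/
lemma IsAnalyticOnDisc.poissonExtension_slice {u : 𝔻 → ℂ} (hu : IsAnalyticOnDisc u) {r : ℝ}
    (hr : r ∈ Ico (0 : ℝ) 1) (z : 𝔻) : poissonExtension (slice u r) z = discExtend u (r * z) := by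
  rw [poissonExtension_eq]
  refine integral_poissonKernel_mul (f := fun w => discExtend u (r * w)) ?_ z.norm_lt_one
  have h : DifferentiableOn ℂ (fun w => discExtend u (r * w)) (closure (Metric.ball 0 1)) := by
    refine hu.differentiableOn.comp (by fun_prop) fun w hw => ?_
    have hw' : ‖w‖ ≤ 1 := by
      simpa using Metric.closure_ball_subset_closedBall hw
    rw [mem_ball_zero_iff, norm_mul]
    exact (mul_le_of_le_one_right (norm_nonneg _) hw').trans_lt (norm_ofReal_lt_one hr)
  exact h.diffContOnCl

/-- Dilation semigroup: restricting an analytic function to a smaller circle is averaging its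
restriction to a larger one against the Poisson kernel. -/
lemma IsAnalyticOnDisc.slice_mul {u : 𝔻 → ℂ} (hu : IsAnalyticOnDisc u) {r ρ : ℝ}
    (hr : r ∈ Ico (0 : ℝ) 1) (hρ : ρ ∈ Ico (0 : ℝ) 1) :
    slice u (r * ρ) = poissonAverage ρ (slice u r) := by
  rw [← slice_poissonExtension _ hρ]
  ext θ
  have hz : ‖(ρ : ℂ) * (AddCircle.toCircle θ : ℂ)‖ < 1 := by
    rw [norm_mul, Circle.norm_coe, mul_one]
    exact norm_ofReal_lt_one hρ
  rw [slice, slice, ← Complex.UnitDisc.coe_mk _ hz, discExtend_coe, hu.poissonExtension_slice hr,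
    Complex.UnitDisc.coe_mk]
  push_cast
  rw [mul_assoc]

/-! ### Approximation of the identity in the Gagliardo seminorm -/

lemma norm_toCircle_sub_one_le {r : ℝ} (hr : r ∈ Ico (0 : ℝ) 1) (t : Torus) :
    ‖(AddCircle.toCircle t : ℂ) - 1‖ ≤ 2 * ‖(AddCircle.toCircle t : ℂ) - r‖ ∧
      1 - r ≤ ‖(AddCircle.toCircle t : ℂ) - r‖ := by
  have h1 : 1 - r ≤ ‖(AddCircle.toCircle t : ℂ) - r‖ := by
    have := norm_sub_norm_le (AddCircle.toCircle t : ℂ) (r : ℂ)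
    rwa [Circle.norm_coe, Complex.norm_real, Real.norm_eq_abs, abs_of_nonneg hr.1] at this
  have h2 : ‖(r : ℂ) - 1‖ = 1 - r := by
    rw [← Complex.ofReal_one, ← Complex.ofReal_sub, Complex.norm_real, Real.norm_eq_abs,
      abs_sub_comm, abs_of_nonneg (by linarith [hr.2])]
  have h3 := norm_sub_le_norm_sub_add_norm_sub (AddCircle.toCircle t : ℂ) (r : ℂ) 1
  exact ⟨by linarith, h1⟩

/-- The constant in the bound of the Poisson kernel by the singular weight
`|e^{it} - 1|^{-(1 + sp)}`. It tends to `0` as `r → 1⁻`. -/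
def kernelConst (s p r : ℝ) : ℝ := 2 ^ (2 + s * p) * (1 - r) ^ min (s * p) 1

lemma kernelConst_pos (s p : ℝ) {r : ℝ} (hr : r < 1) : 0 < kernelConst s p r := by
  have : 0 < 1 - r := by linarith
  unfold kernelConst
  positivity

lemma tendsto_kernelConst {s p : ℝ} (hsp : 0 < s * p) :
    Tendsto (kernelConst s p) (𝓝 1) (𝓝 0) := by
  have ha : 0 < min (s * p) 1 := lt_min hsp one_pos
  have h : ContinuousAt (kernelConst s p) 1 := by
    unfold kernelConst
    exact continuousAt_const.mul
      ((continuousAt_const.sub continuousAt_id).rpow_const (Or.inr ha.le))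
  have h0 : kernelConst s p 1 = 0 := by simp [kernelConst, Real.zero_rpow ha.ne']
  simpa [ContinuousAt, h0] using h

/-- With `D = |e^{it} - r|` and `d = |e^{it} - 1|`, the kernel is at most `2 (1 - r) / D ^ 2`, while
`d ≤ 2`, `d ≤ 2 D` and `1 - r ≤ D`. -/
lemma poissonKernel_mul_rpow_le {s p r : ℝ} (hsp : 0 < s * p) (hr : r ∈ Ico (0 : ℝ) 1) (t : Torus) :
    poissonKernel 0 (r : ℂ) (AddCircle.toCircle t : ℂ)
      * ‖(AddCircle.toCircle t : ℂ) - 1‖ ^ (1 + s * p) ≤ kernelConst s p r := by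
  obtain ⟨hd, hD⟩ := norm_toCircle_sub_one_le hr t
  have hd2 : ‖(AddCircle.toCircle t : ℂ) - 1‖ ≤ 2 := by
    refine (norm_sub_le _ _).trans ?_
    rw [Circle.norm_coe, norm_one]
    norm_num
  have hK : poissonKernel 0 (r : ℂ) (AddCircle.toCircle t : ℂ)
      = (1 - r ^ 2) / ‖(AddCircle.toCircle t : ℂ) - r‖ ^ 2 := by
    simp [poissonKernel_def, Circle.norm_coe]
  rw [hK]
  set D := ‖(AddCircle.toCircle t : ℂ) - r‖
  set d := ‖(AddCircle.toCircle t : ℂ) - 1‖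
  have hd0 : 0 ≤ d := norm_nonneg _
  have hr1 : 0 < 1 - r := by linarith [hr.2]
  have hD0 : 0 < D := hr1.trans_le hD
  set a := min (s * p) 1 with ha
  have ha0 : 0 < a := lt_min hsp one_pos
  have ha1 : a ≤ 1 := min_le_right _ _
  have hasp : a ≤ s * p := min_le_left _ _
  -- Split the exponent so that `d ≤ 2` and `d ≤ 2 D` are each used on one factor.
  have e1 : d ^ (1 + s * p) ≤ 2 ^ (s * p - a) * (2 * D) ^ (1 + a) := by
    have : 1 + s * p = (s * p - a) + (1 + a) := by ring
    rw [this, Real.rpow_add_of_nonneg hd0 (by linarith) (by linarith)]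
    gcongr
  have e2 : (2 : ℝ) ^ (s * p - a) * (2 * D) ^ (1 + a)
      = 2 ^ (1 + s * p) * (D ^ 2 * D ^ (a - 1)) := by
    rw [Real.mul_rpow two_pos.le hD0.le, ← mul_assoc, ← Real.rpow_add two_pos, ← Real.rpow_natCast,
      ← Real.rpow_add hD0]
    congr 2
    · ring
    · push_cast; ring
  have e3 : D ^ (a - 1) ≤ (1 - r) ^ (a - 1) :=
    Real.rpow_le_rpow_of_nonpos hr1 hD (by linarith)
  have e4 : 1 - r ^ 2 ≤ 2 * (1 - r) := by nlinarith [hr.1, sq_nonneg (1 - r)]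
  have e5 : 0 ≤ 1 - r ^ 2 := by nlinarith [hr.1]
  calc (1 - r ^ 2) / D ^ 2 * d ^ (1 + s * p)
      ≤ (1 - r ^ 2) / D ^ 2 * (2 ^ (1 + s * p) * (D ^ 2 * D ^ (a - 1))) := by
        rw [← e2]; gcongr
    _ = (1 - r ^ 2) * (2 ^ (1 + s * p) * D ^ (a - 1)) := by field_simp
    _ ≤ 2 * (1 - r) * (2 ^ (1 + s * p) * (1 - r) ^ (a - 1)) := by gcongr
    _ = kernelConst s p r := by
        have h2 : (2 : ℝ) ^ (2 + s * p) = 2 * 2 ^ (1 + s * p) := by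
          rw [show 2 + s * p = 1 + (1 + s * p) by ring, Real.rpow_add two_pos, Real.rpow_one]
        have h3 : (1 - r) ^ a = (1 - r) * (1 - r) ^ (a - 1) := by
          rw [Real.rpow_sub_one hr1.ne']; field_simp
        rw [kernelConst, ← ha, h2, h3]; ring

/-- Jensen's inequality for `x ↦ x ^ p` and vector-valued means. -/
lemma enorm_integral_rpow_le {α : Type*} [MeasurableSpace α] {μ : Measure α}
    [IsProbabilityMeasure μ] {p : ℝ} (hp : 1 ≤ p) {F : α → ℂ} (hF : AEStronglyMeasurable F μ) :
    ‖∫ x, F x ∂μ‖ₑ ^ p ≤ ∫⁻ x, ‖F x‖ₑ ^ p ∂μ := by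
  have h0 : 0 < p := by linarith
  have h1 : ‖∫ x, F x ∂μ‖ₑ ≤ (∫⁻ x, ‖F x‖ₑ ^ p ∂μ) ^ (1 / p) := by
    refine (enorm_integral_le_lintegral_enorm _).trans ?_
    have := eLpNorm'_le_eLpNorm'_of_exponent_le one_pos hp μ hF
    simpa [eLpNorm'] using this
  calc ‖∫ x, F x ∂μ‖ₑ ^ p ≤ ((∫⁻ x, ‖F x‖ₑ ^ p ∂μ) ^ (1 / p)) ^ p := by gcongr
    _ = ∫⁻ x, ‖F x‖ₑ ^ p ∂μ := by
      rw [← ENNReal.rpow_mul, one_div_mul_cancel h0.ne', ENNReal.rpow_one]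

/-- The inner integral of the Gagliardo seminorm, at the point `θ`. -/
def gagliardoDensity (s p : ℝ) (g : Torus → ℂ) (θ : Torus) : ℝ≥0∞ :=
  ∫⁻ t : Torus, ‖g θ - g t‖ₑ ^ p /
    ‖(AddCircle.toCircle θ : ℂ) - (AddCircle.toCircle t : ℂ)‖ₑ ^ (1 + s * p)

lemma aemeasurable_gagliardo_integrand {s p : ℝ} {g : Torus → ℂ}
    (hg : AEStronglyMeasurable g volume) :
    AEMeasurable (fun z : Torus × Torus => ‖g z.1 - g z.2‖ₑ ^ p /
      ‖(AddCircle.toCircle z.1 : ℂ) - (AddCircle.toCircle z.2 : ℂ)‖ₑ ^ (1 + s * p)) volume := by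
  have h1 : AEStronglyMeasurable (fun z : Torus × Torus => g z.1 - g z.2) volume :=
    (hg.comp_quasiMeasurePreserving Measure.quasiMeasurePreserving_fst).sub
      (hg.comp_quasiMeasurePreserving Measure.quasiMeasurePreserving_snd)
  have hcont : Continuous fun z : Torus × Torus =>
      (AddCircle.toCircle z.1 : ℂ) - (AddCircle.toCircle z.2 : ℂ) :=
    (continuous_coe_toCircle.comp continuous_fst).sub (continuous_coe_toCircle.comp continuous_snd)
  exact (h1.enorm.pow_const _).div (hcont.measurable.enorm.pow_const _).aemeasurable

lemma lintegral_gagliardoDensity {s p : ℝ} (hp : 1 < p) {g : Torus → ℂ}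
    (hg : AEStronglyMeasurable g volume) :
    ∫⁻ θ, gagliardoDensity s p g θ = gagliardo s p g ^ p := by
  rw [gagliardo, ← ENNReal.rpow_mul, one_div_mul_cancel (by linarith), ENNReal.rpow_one,
    Measure.volume_eq_prod, lintegral_prod _ (aemeasurable_gagliardo_integrand hg)]
  rfl

lemma aemeasurable_gagliardoDensity {s p : ℝ} {g : Torus → ℂ}
    (hg : AEStronglyMeasurable g volume) : AEMeasurable (gagliardoDensity s p g) :=
  (aemeasurable_gagliardo_integrand (s := s) (p := p) hg).lintegral_prod_right'

/-- Pointwise approximation: Jensen's inequality for `poissonMeasure r`, followed by the bound of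
the kernel by the singular weight. -/
lemma enorm_poissonAverage_sub_rpow_le {s p : ℝ} (hp : 1 < p) (hsp : 0 < s * p) {g : Torus → ℂ}
    (hg : Integrable g) {r : ℝ} (hr : r ∈ Ico (0 : ℝ) 1) (θ : Torus) :
    ‖poissonAverage r g θ - g θ‖ₑ ^ p
      ≤ ENNReal.ofReal (kernelConst s p r) * gagliardoDensity s p g θ := by
  have := isProbabilityMeasure_poissonMeasure hr
  have hi := integrable_translate_poissonMeasure hg hr θ
  have hsub : poissonAverage r g θ - g θ = ∫ t, (g (t + θ) - g θ) ∂poissonMeasure r := by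
    rw [integral_sub hi (integrable_const _), integral_const, probReal_univ, one_smul,
      poissonAverage]
  have hm : AEStronglyMeasurable (fun t => g (t + θ) - g θ) (poissonMeasure r) :=
    (hi.sub (integrable_const _)).aestronglyMeasurable
  rw [hsub]
  refine (enorm_integral_rpow_le hp.le hm).trans ?_
  rw [lintegral_poissonMeasure hr, gagliardoDensity,
    ← lintegral_const_mul' _ _ ENNReal.ofReal_ne_top,
    ← lintegral_add_right_eq_self (fun t => ENNReal.ofReal (kernelConst s p r) * (‖g θ - g t‖ₑ ^ p /
      ‖(AddCircle.toCircle θ : ℂ) - (AddCircle.toCircle t : ℂ)‖ₑ ^ (1 + s * p))) θ]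
  refine (lintegral_mono' haarAddCircle_le_volume le_rfl).trans (lintegral_mono fun t => ?_)
  have hdist : ‖(AddCircle.toCircle θ : ℂ) - (AddCircle.toCircle (t + θ) : ℂ)‖ₑ
      = ENNReal.ofReal ‖(AddCircle.toCircle t : ℂ) - 1‖ := by
    rw [ofReal_norm, AddCircle.toCircle_add, Circle.coe_mul, ← enorm_neg,
      show -((AddCircle.toCircle θ : ℂ) - AddCircle.toCircle t * AddCircle.toCircle θ)
        = ((AddCircle.toCircle t : ℂ) - 1) * AddCircle.toCircle θ by ring, enorm_mul]
    rw [← ofReal_norm (AddCircle.toCircle θ : ℂ), Circle.norm_coe, ENNReal.ofReal_one,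
      mul_one]
  -- At `t = 0` the weight vanishes and the right-hand side is `∞`.
  have hk : ENNReal.ofReal (poissonKernel 0 (r : ℂ) (AddCircle.toCircle t : ℂ)) ≤
      ENNReal.ofReal (kernelConst s p r) /
        ‖(AddCircle.toCircle θ : ℂ) - (AddCircle.toCircle (t + θ) : ℂ)‖ₑ ^ (1 + s * p) := by
    rw [ENNReal.le_div_iff_mul_le
      (Or.inr (ENNReal.ofReal_pos.2 (kernelConst_pos s p hr.2)).ne')
      (Or.inr ENNReal.ofReal_ne_top), hdist,
      ENNReal.ofReal_rpow_of_nonneg (norm_nonneg _) (by linarith),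
      ← ENNReal.ofReal_mul (poissonKernel_toCircle_nonneg (norm_ofReal_lt_one hr) t)]
    exact ENNReal.ofReal_le_ofReal (poissonKernel_mul_rpow_le hsp hr t)
  calc _ ≤ ENNReal.ofReal (kernelConst s p r) /
        ‖(AddCircle.toCircle θ : ℂ) - (AddCircle.toCircle (t + θ) : ℂ)‖ₑ ^ (1 + s * p)
        * ‖g (t + θ) - g θ‖ₑ ^ p := by gcongr
    _ = _ := by
      rw [← enorm_neg (g (t + θ) - g θ), neg_sub, div_eq_mul_inv, div_eq_mul_inv]
      ring

lemma eLpNorm_ofReal_eq {p : ℝ} (hp : 1 < p) (f : Torus → ℂ) :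
    eLpNorm f (ENNReal.ofReal p) volume = (∫⁻ θ, ‖f θ‖ₑ ^ p) ^ (1 / p) := by
  have h0 : 0 < p := by linarith
  rw [eLpNorm_eq_lintegral_rpow_enorm_toReal (ENNReal.ofReal_pos.2 h0).ne' ENNReal.ofReal_ne_top,
    ENNReal.toReal_ofReal h0.le]

/-- The Poisson averages converge in `L^p`, at a rate that depends on the seminorm only. -/
lemma eLpNorm_poissonAverage_sub_le {s p : ℝ} (hp : 1 < p) (hsp : 0 < s * p) {g : Torus → ℂ}
    (hg : Integrable g) {r : ℝ} (hr : r ∈ Ico (0 : ℝ) 1) :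
    eLpNorm (fun θ => poissonAverage r g θ - g θ) (ENNReal.ofReal p) volume
      ≤ ENNReal.ofReal (kernelConst s p r ^ (1 / p)) * gagliardo s p g := by
  have h0 : 0 < p := by linarith
  rw [eLpNorm_ofReal_eq hp]
  calc _ ≤ (∫⁻ θ, ENNReal.ofReal (kernelConst s p r) * gagliardoDensity s p g θ) ^ (1 / p) :=
        ENNReal.rpow_le_rpow
          (lintegral_mono fun θ => enorm_poissonAverage_sub_rpow_le hp hsp hg hr θ) (by positivity)
    _ = _ := by
      rw [lintegral_const_mul' _ _ ENNReal.ofReal_ne_top,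
        lintegral_gagliardoDensity hp hg.aestronglyMeasurable,
        ENNReal.mul_rpow_of_nonneg _ _ (by positivity), ← ENNReal.rpow_mul,
        mul_one_div_cancel h0.ne', ENNReal.rpow_one,
        ENNReal.ofReal_rpow_of_pos (kernelConst_pos s p hr.2)]

/-- Radial convergence of Poisson integrals, at every point where the inner integral of the
Gagliardo seminorm is finite. -/
lemma ae_tendsto_poissonAverage {s p : ℝ} (hp : 1 < p) (hsp : 0 < s * p) {g : Torus → ℂ}
    (hg : Integrable g) (h : gagliardo s p g < ⊤) :
    ∀ᵐ θ : Torus, Tendsto (fun r => poissonAverage r g θ) (𝓝[<] 1) (𝓝 (g θ)) := by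
  have h0 : 0 < p := by linarith
  have hfin : ∀ᵐ θ : Torus, gagliardoDensity s p g θ < ⊤ := by
    refine ae_lt_top' (aemeasurable_gagliardoDensity hg.aestronglyMeasurable) ?_
    rw [lintegral_gagliardoDensity hp hg.aestronglyMeasurable]
    exact ENNReal.rpow_ne_top_of_nonneg h0.le h.ne
  filter_upwards [hfin] with θ hθ
  rw [tendsto_iff_edist_tendsto_0]
  have hlim : Tendsto (fun r => (ENNReal.ofReal (kernelConst s p r)
      * gagliardoDensity s p g θ) ^ (1 / p)) (𝓝[<] 1) (𝓝 0) := by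
    have h1 : Tendsto (fun r => ENNReal.ofReal (kernelConst s p r)) (𝓝[<] 1) (𝓝 0) := by
      have := ENNReal.tendsto_ofReal ((tendsto_kernelConst hsp).mono_left
        (nhdsWithin_le_nhds (s := Iio 1)))
      rwa [ENNReal.ofReal_zero] at this
    have h2 := ENNReal.Tendsto.mul_const h1 (Or.inr hθ.ne)
    rw [zero_mul] at h2
    have h3 := h2.ennrpow_const (1 / p)
    rwa [ENNReal.zero_rpow_of_pos (by positivity)] at h3
  refine tendsto_of_tendsto_of_tendsto_of_le_of_le' tendsto_const_nhds hlim
    (Eventually.of_forall fun _ => zero_le) ?_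
  have hev : ∀ᶠ r : ℝ in 𝓝[<] 1, r ∈ Ioo (0 : ℝ) 1 := Ioo_mem_nhdsLT one_pos
  filter_upwards [hev] with r hr
  rw [edist_eq_enorm_sub, one_div, ENNReal.le_rpow_inv_iff h0]
  exact enorm_poissonAverage_sub_rpow_le hp hsp hg ⟨hr.1.le, hr.2⟩ θ

/-! ### Contractivity and lower semicontinuity of the seminorm -/

lemma poissonAverage_congr {r : ℝ} {f g : Torus → ℂ} (h : f =ᵐ[volume] g) :
    poissonAverage r f = poissonAverage r g := by
  ext θ
  refine integral_congr_ae ((poissonMeasure_absolutelyContinuous r).ae_eq ?_)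
  exact (measurePreserving_add_right volume θ).quasiMeasurePreserving.ae_eq_comp h

lemma gagliardo_translate (s p : ℝ) {g : Torus → ℂ} (hg : Measurable g) (t : Torus) :
    gagliardo s p (fun θ => g (t + θ)) = gagliardo s p g := by
  unfold gagliardo
  congr 1
  have hmp : MeasurePreserving (fun z : Torus × Torus => (t + z.1, t + z.2)) volume volume := by
    have := (measurePreserving_add_left (volume : Measure Torus) t).prod
      (measurePreserving_add_left (volume : Measure Torus) t)
    exact this
  have hmeas : Measurable fun z : Torus × Torus => ‖g z.1 - g z.2‖ₑ ^ p /
      ‖(AddCircle.toCircle z.1 : ℂ) - (AddCircle.toCircle z.2 : ℂ)‖ₑ ^ (1 + s * p) :=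
    (((hg.comp measurable_fst).sub (hg.comp measurable_snd)).enorm.pow_const _).div
      (((continuous_coe_toCircle.measurable.comp measurable_fst).sub
        (continuous_coe_toCircle.measurable.comp measurable_snd)).enorm.pow_const _)
  rw [← hmp.lintegral_comp hmeas]
  refine lintegral_congr fun z => ?_
  simp only [AddCircle.toCircle_add, Circle.coe_mul, ← mul_sub, enorm_mul]
  rw [← ofReal_norm (AddCircle.toCircle t : ℂ), Circle.norm_coe, ENNReal.ofReal_one,
    one_mul]

/-- A Poisson average is a mean of translates, and these all have the same seminorm. -/
lemma gagliardo_poissonAverage_le {s p : ℝ} (hp : 1 < p) {g : Torus → ℂ} (hg : Integrable g)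
    {r : ℝ} (hr : r ∈ Ico (0 : ℝ) 1) :
    gagliardo s p (poissonAverage r g) ≤ gagliardo s p g := by
  have h0 : 0 < p := by linarith
  wlog hgm : Measurable g generalizing g
  · obtain ⟨g', hg', hae⟩ := hg.aestronglyMeasurable
    rw [poissonAverage_congr hae, gagliardo_congr hae]
    exact this (hg.congr hae) hg'.measurable
  have := isProbabilityMeasure_poissonMeasure hr
  have hpow : ∀ f : Torus → ℂ, gagliardo s p f ^ p = ∫⁻ z : Torus × Torus, ‖f z.1 - f z.2‖ₑ ^ p /
      ‖(AddCircle.toCircle z.1 : ℂ) - (AddCircle.toCircle z.2 : ℂ)‖ₑ ^ (1 + s * p) := by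
    intro f
    rw [gagliardo, ← ENNReal.rpow_mul, one_div_mul_cancel h0.ne', ENNReal.rpow_one]
  rw [← ENNReal.rpow_le_rpow_iff h0, hpow]
  have hw : Measurable fun z : Torus × Torus =>
      ‖(AddCircle.toCircle z.1 : ℂ) - (AddCircle.toCircle z.2 : ℂ)‖ₑ ^ (1 + s * p) :=
    ((continuous_coe_toCircle.measurable.comp measurable_fst).sub
      (continuous_coe_toCircle.measurable.comp measurable_snd)).enorm.pow_const _
  calc _ ≤ ∫⁻ z : Torus × Torus, ∫⁻ t, ‖g (t + z.1) - g (t + z.2)‖ₑ ^ p /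
      ‖(AddCircle.toCircle z.1 : ℂ) - (AddCircle.toCircle z.2 : ℂ)‖ₑ ^ (1 + s * p)
        ∂poissonMeasure r := by
        refine lintegral_mono fun z => ?_
        have h1 := integrable_translate_poissonMeasure hg hr z.1
        have h2 := integrable_translate_poissonMeasure hg hr z.2
        have h3 : AEStronglyMeasurable (fun t => g (t + z.1) - g (t + z.2)) (poissonMeasure r) :=
          (h1.sub h2).aestronglyMeasurable
        simp only [div_eq_mul_inv]
        rw [lintegral_mul_const'' _ (h3.enorm.pow_const p)]
        gcongr
        rw [poissonAverage, poissonAverage, ← integral_sub h1 h2]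
        exact enorm_integral_rpow_le hp.le h3
    _ = ∫⁻ t, (∫⁻ z : Torus × Torus, ‖g (t + z.1) - g (t + z.2)‖ₑ ^ p /
      ‖(AddCircle.toCircle z.1 : ℂ) - (AddCircle.toCircle z.2 : ℂ)‖ₑ ^ (1 + s * p))
        ∂poissonMeasure r := by
        rw [lintegral_lintegral_swap]
        refine Measurable.aemeasurable (Measurable.div ?_ (hw.comp measurable_fst))
        refine (Measurable.sub ?_ ?_).enorm.pow_const _
        · exact hgm.comp (measurable_snd.add (measurable_fst.comp measurable_fst))
        · exact hgm.comp (measurable_snd.add (measurable_snd.comp measurable_fst))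
    _ = ∫⁻ t, gagliardo s p g ^ p ∂poissonMeasure r := by
        refine lintegral_congr fun t => ?_
        rw [← gagliardo_translate s p hgm t, hpow]
    _ = gagliardo s p g ^ p := by simp

/-- Fatou's lemma for the seminorm. -/
lemma gagliardo_le_liminf {s p : ℝ} (hp : 1 < p) {f : ℕ → Torus → ℂ} {g : Torus → ℂ}
    (hf : ∀ n, AEStronglyMeasurable (f n) volume)
    (h : ∀ᵐ θ : Torus, Tendsto (fun n => f n θ) atTop (𝓝 (g θ))) :
    gagliardo s p g ≤ liminf (fun n => gagliardo s p (f n)) atTop := by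
  have h0 : 0 < p := by linarith
  have h1 : ∀ᵐ z : Torus × Torus, Tendsto (fun n => f n z.1) atTop (𝓝 (g z.1)) :=
    Measure.quasiMeasurePreserving_fst.ae h
  have h2 : ∀ᵐ z : Torus × Torus, Tendsto (fun n => f n z.2) atTop (𝓝 (g z.2)) :=
    Measure.quasiMeasurePreserving_snd.ae h
  have hfatou := lintegral_liminf_le' (u := atTop)
    fun n => aemeasurable_gagliardo_integrand (s := s) (p := p) (hf n)
  have hmono : Monotone fun x : ℝ≥0∞ => x ^ (1 / p) :=
    ENNReal.monotone_rpow_of_nonneg (by positivity)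
  have hlim := hmono.map_liminf_of_continuousAt (F := atTop)
    (fun n => ∫⁻ z : Torus × Torus, ‖f n z.1 - f n z.2‖ₑ ^ p /
      ‖(AddCircle.toCircle z.1 : ℂ) - (AddCircle.toCircle z.2 : ℂ)‖ₑ ^ (1 + s * p))
    ENNReal.continuous_rpow_const.continuousAt
  refine le_trans ?_ hlim.le
  refine ENNReal.rpow_le_rpow (le_trans (lintegral_mono_ae ?_) hfatou) (by positivity)
  filter_upwards [h1, h2] with z hz1 hz2
  -- On the diagonal the integrand of the limit is `0 / 0 = 0`.
  by_cases hz : z.1 = z.2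
  · simp [hz, h0]
  refine (Tendsto.liminf_eq ?_).ge
  refine ENNReal.Tendsto.div_const ((hz1.sub hz2).enorm.ennrpow_const p) (Or.inr ?_)
  have hne : (AddCircle.toCircle z.1 : ℂ) - (AddCircle.toCircle z.2 : ℂ) ≠ 0 := by
    rw [sub_ne_zero]
    intro he
    exact hz (AddCircle.injective_toCircle Real.two_pi_pos.ne' (Circle.ext he))
  exact (ENNReal.rpow_pos (enorm_pos.2 hne) enorm_ne_top).ne'

/-! ### Analyticity of the Poisson extension -/

/-- Termwise integration of a geometric series. -/
lemma hasSum_integral_geometric {g F : Torus → ℂ} (hg : Integrable g AddCircle.haarAddCircle)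
    (hF : Continuous F) (hF1 : ∀ t, ‖F t‖ = 1) {ζ : ℂ} (hζ : ‖ζ‖ < 1) :
    HasSum (fun n : ℕ => ζ ^ n * ∫ t, F t ^ n * g t ∂AddCircle.haarAddCircle)
      (∫ t, (1 - ζ * F t)⁻¹ * g t ∂AddCircle.haarAddCircle) := by
  have hint : ∀ n : ℕ, Integrable (fun t => (ζ * F t) ^ n * g t) AddCircle.haarAddCircle := by
    intro n
    refine hg.bdd_mul (c := ‖ζ‖ ^ n)
      ((continuous_const.mul hF).pow n).aestronglyMeasurable (ae_of_all _ fun t => ?_)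
    rw [norm_pow, norm_mul, hF1, mul_one]
  have hsum : Summable fun n : ℕ => ∫ t, ‖(ζ * F t) ^ n * g t‖ ∂AddCircle.haarAddCircle := by
    simp only [norm_mul, norm_pow, hF1, mul_one, integral_const_mul]
    exact (summable_geometric_of_lt_one (norm_nonneg _) hζ).mul_right _
  have h := hasSum_integral_of_summable_integral_norm hint hsum
  have hL : ∀ n : ℕ, ∫ t, (ζ * F t) ^ n * g t ∂AddCircle.haarAddCircle
      = ζ ^ n * ∫ t, F t ^ n * g t ∂AddCircle.haarAddCircle := by
    intro n
    rw [← integral_const_mul]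
    simp only [mul_pow, mul_assoc]
  have hR : ∀ t, ∑' n : ℕ, (ζ * F t) ^ n * g t = (1 - ζ * F t)⁻¹ * g t := by
    intro t
    rw [tsum_mul_right, tsum_geometric_of_norm_lt_one]
    rwa [norm_mul, hF1, mul_one]
  simpa only [hL, hR] using h

lemma fourierCoeff_eq_integral_pow (g : Torus → ℂ) (n : ℕ) :
    fourierCoeff g n = ∫ t, (starRingEnd ℂ (AddCircle.toCircle t : ℂ)) ^ n * g t
      ∂AddCircle.haarAddCircle := by
  refine integral_congr_ae (ae_of_all _ fun t => ?_)
  change fourier (-(n : ℤ)) t • g t = _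
  rw [fourier_neg, fourier_apply, AddCircle.toCircle_zsmul, zpow_natCast, Circle.coe_pow, map_pow,
    smul_eq_mul]

lemma fourierCoeff_neg_eq_integral_pow (g : Torus → ℂ) (n : ℕ) :
    fourierCoeff g (-n) = ∫ t, (AddCircle.toCircle t : ℂ) ^ n * g t
      ∂AddCircle.haarAddCircle := by
  refine integral_congr_ae (ae_of_all _ fun t => ?_)
  simp only [neg_neg, fourier_apply, AddCircle.toCircle_zsmul, zpow_natCast, Circle.coe_pow,
    smul_eq_mul]

/-- On the unit circle the Poisson kernel is the sum of a holomorphic and an antiholomorphic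
function of `z`, each a geometric series. -/
lemma poissonKernel_eq_geometric {z w : ℂ} (hz : ‖z‖ < 1) (hw : ‖w‖ = 1) :
    (poissonKernel 0 z w : ℂ)
      = (1 - z * starRingEnd ℂ w)⁻¹ + (1 - starRingEnd ℂ z * w)⁻¹ - 1 := by
  have hww : w * starRingEnd ℂ w = 1 := by
    rw [Complex.mul_conj, Complex.normSq_eq_norm_sq, hw]; norm_num
  have h1 : 1 - z * starRingEnd ℂ w ≠ 0 := by
    intro h
    have : ‖z * starRingEnd ℂ w‖ = 1 := by rw [← sub_eq_zero.1 h, norm_one]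
    rw [norm_mul, RCLike.norm_conj, hw, mul_one] at this
    exact hz.ne this
  have h2 : 1 - starRingEnd ℂ z * w ≠ 0 := by
    intro h
    have : ‖starRingEnd ℂ z * w‖ = 1 := by rw [← sub_eq_zero.1 h, norm_one]
    rw [norm_mul, RCLike.norm_conj, hw, mul_one] at this
    exact hz.ne this
  have h3 : ((‖w - z‖ ^ 2 : ℝ) : ℂ) = (1 - z * starRingEnd ℂ w) * (1 - starRingEnd ℂ z * w) := by
    rw [← Complex.normSq_eq_norm_sq, Complex.normSq_eq_conj_mul_self, map_sub]
    linear_combination (1 - z * starRingEnd ℂ z) * hww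
  have h4 : ((‖w‖ ^ 2 - ‖z‖ ^ 2 : ℝ) : ℂ) = 1 - z * starRingEnd ℂ z := by
    rw [hw, Complex.mul_conj, Complex.normSq_eq_norm_sq]; push_cast; ring
  rw [poissonKernel_def, sub_zero, sub_zero, Complex.ofReal_div, h3, h4]
  field_simp
  linear_combination (z * starRingEnd ℂ z) * hww

/-- When the Fourier coefficients of negative index vanish, the antiholomorphic half of the Poisson
kernel contributes nothing and the extension is the power series of the other coefficients. -/
lemma hasSum_poissonExtension {g : Torus → ℂ} (hg : Integrable g AddCircle.haarAddCircle)
    (hneg : ∀ k : ℤ, k < 0 → fourierCoeff g k = 0) (z : 𝔻) :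
    HasSum (fun n : ℕ => (z : ℂ) ^ n * fourierCoeff g n) (poissonExtension g z) := by
  have hz := z.norm_lt_one
  have hz' : ‖starRingEnd ℂ (z : ℂ)‖ < 1 := by rwa [RCLike.norm_conj]
  have hc := continuous_coe_toCircle
  have h1 := hasSum_integral_geometric hg (F := fun t => starRingEnd ℂ (AddCircle.toCircle t : ℂ))
    (Complex.continuous_conj.comp hc) (fun t => by rw [RCLike.norm_conj, Circle.norm_coe]) hz
  have h2 := hasSum_integral_geometric hg (F := fun t => (AddCircle.toCircle t : ℂ))
    hc (fun t => Circle.norm_coe _) hz'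
  simp only [← fourierCoeff_eq_integral_pow] at h1
  simp only [← fourierCoeff_neg_eq_integral_pow] at h2
  have hzero : ∀ n : ℕ, n ≠ 0 →
      starRingEnd ℂ (z : ℂ) ^ n * fourierCoeff g (-(n : ℤ)) = 0 := by
    intro n hn
    rw [hneg _ (by omega), mul_zero]
  have h3 := h2.unique (hasSum_single 0 fun n hn => hzero n hn)
  have hb : ∀ {ζ : ℂ} {F : Torus → ℂ}, ‖ζ‖ < 1 → Continuous F → (∀ t, ‖F t‖ = 1) →
      Integrable (fun t => (1 - ζ * F t)⁻¹ * g t) AddCircle.haarAddCircle := by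
    intro ζ F hζ hF hF1
    have hne : ∀ t, 1 - ζ * F t ≠ 0 := by
      intro t h
      have : ‖ζ * F t‖ = 1 := by rw [← sub_eq_zero.1 h, norm_one]
      rw [norm_mul, hF1, mul_one] at this
      exact hζ.ne this
    have hcont := (continuous_const.sub (continuous_const.mul hF)).inv₀ hne
    obtain ⟨C, hC⟩ := isCompact_univ.exists_bound_of_continuousOn hcont.continuousOn
    exact hg.bdd_mul hcont.aestronglyMeasurable (ae_of_all _ fun t => hC t (mem_univ t))
  have i1 := hb (F := fun t => starRingEnd ℂ (AddCircle.toCircle t : ℂ)) hz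
    (Complex.continuous_conj.comp hc) (fun t => by rw [RCLike.norm_conj, Circle.norm_coe])
  have i2 := hb hz' hc (fun t => Circle.norm_coe _)
  have i12 : Integrable (fun t => (1 - (z : ℂ) * starRingEnd ℂ (AddCircle.toCircle t : ℂ))⁻¹ * g t
      + (1 - starRingEnd ℂ (z : ℂ) * AddCircle.toCircle t)⁻¹ * g t) AddCircle.haarAddCircle :=
    i1.add i2
  have h0 : fourierCoeff g (-((0 : ℕ) : ℤ)) = ∫ t, g t ∂AddCircle.haarAddCircle := by
    rw [fourierCoeff_neg_eq_integral_pow]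
    simp
  have heq : poissonExtension g z = ∫ t, (1 - (z : ℂ) * starRingEnd ℂ (AddCircle.toCircle t : ℂ))⁻¹
      * g t ∂AddCircle.haarAddCircle := by
    rw [poissonExtension_eq]
    simp only [poissonKernel_eq_geometric hz (Circle.norm_coe _), sub_mul, add_mul, one_mul]
    rw [integral_sub i12 hg, integral_add i1 i2, h3, pow_zero, one_mul, h0,
      add_sub_cancel_right]
  rw [heq]
  exact h1

lemma isAnalyticOnDisc_poissonExtension {g : Torus → ℂ}
    (hg : Integrable g AddCircle.haarAddCircle) (hneg : ∀ k : ℤ, k < 0 → fourierCoeff g k = 0) :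
    IsAnalyticOnDisc (poissonExtension g) := by
  let P := FormalMultilinearSeries.ofScalars ℂ fun n : ℕ => fourierCoeff g n
  have hrad : ((1 : NNReal) : ℝ≥0∞) ≤ P.radius := by
    refine P.le_radius_of_bound (∫ t, ‖g t‖ ∂AddCircle.haarAddCircle) fun n => ?_
    rw [NNReal.coe_one, one_pow, mul_one, FormalMultilinearSeries.ofScalars_norm]
    refine (norm_integral_le_integral_norm _).trans_eq (integral_congr_ae (ae_of_all _ fun t => ?_))
    simp only [norm_smul, fourier_apply, Circle.norm_coe, one_mul]
  have hrad' : (1 : ℝ≥0∞) ≤ P.radius := by simpa using hrad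
  have hball := (P.hasFPowerSeriesOnBall (one_pos.trans_le hrad')).analyticOnNhd
  have hsub : Metric.ball (0 : ℂ) 1 ⊆ Metric.eball 0 P.radius := by
    intro z hz
    rw [Metric.mem_eball, edist_zero_right]
    refine lt_of_lt_of_le ?_ hrad'
    rw [← ofReal_norm, ENNReal.ofReal_lt_one]
    simpa using hz
  refine (hball.mono hsub).congr Metric.isOpen_ball fun z hz => ?_
  have hz' : ‖z‖ < 1 := by simpa using hz
  rw [← Complex.UnitDisc.coe_mk z hz', discExtend_coe,
    ← (hasSum_poissonExtension hg hneg _).tsum_eq, FormalMultilinearSeries.sum]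
  refine tsum_congr fun n => ?_
  rw [FormalMultilinearSeries.ofScalars_apply_eq, smul_eq_mul, mul_comm]

/-! ### Fourier coefficients and mean values -/

lemma integrable_of_memLp {p : ℝ} (hp : 1 < p) {f : Torus → ℂ}
    (hf : MemLp f (ENNReal.ofReal p) (volume : Measure Torus)) : Integrable f :=
  hf.integrable (by simpa using ENNReal.ofReal_le_ofReal hp.le)

/-- Weighted means over the normalised circle are dominated by the `L^p` norm for the arc length. -/
lemma norm_integral_haar_le {p : ℝ} (hp : 1 < p) {f F : Torus → ℂ} (hF : Continuous F) {C : ℝ}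
    (hF1 : ∀ t, ‖F t‖ ≤ C) (hf : MemLp f (ENNReal.ofReal p) (volume : Measure Torus)) :
    ‖∫ t, F t * f t ∂AddCircle.haarAddCircle‖
      ≤ C * (eLpNorm f (ENNReal.ofReal p) (volume : Measure Torus)).toReal := by
  have h0 : 0 < p := by linarith
  have hC : 0 ≤ C := (norm_nonneg _).trans (hF1 0)
  have hm : AEStronglyMeasurable (fun t => F t * f t) AddCircle.haarAddCircle :=
    hF.aestronglyMeasurable.mul (hf.1.mono_measure haarAddCircle_le_volume)
  rw [← toReal_enorm, ← ENNReal.toReal_ofReal hC, ← ENNReal.toReal_mul]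
  refine ENNReal.toReal_mono (ENNReal.mul_ne_top ENNReal.ofReal_ne_top hf.eLpNorm_ne_top) ?_
  rw [← ENNReal.rpow_le_rpow_iff h0, ENNReal.mul_rpow_of_nonneg _ _ h0.le, eLpNorm_ofReal_eq hp,
    ← ENNReal.rpow_mul, one_div_mul_cancel h0.ne', ENNReal.rpow_one,
    ← lintegral_const_mul' _ _ (ENNReal.rpow_ne_top_of_nonneg h0.le ENNReal.ofReal_ne_top)]
  refine (enorm_integral_rpow_le hp.le hm).trans
    (lintegral_mono' haarAddCircle_le_volume fun t => ?_)
  rw [← ENNReal.mul_rpow_of_nonneg _ _ h0.le, enorm_mul, ← ofReal_norm (F t)]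
  gcongr
  exact hF1 t

lemma norm_fourierCoeff_le {p : ℝ} [hp : Fact (1 < p)] {f : Torus → ℂ}
    (hf : MemLp f (ENNReal.ofReal p) (volume : Measure Torus)) (k : ℤ) :
    ‖fourierCoeff f k‖ ≤ (eLpNorm f (ENNReal.ofReal p) (volume : Measure Torus)).toReal := by
  have h := norm_integral_haar_le hp.out (F := fourier (-k)) (C := 1)
    (fourier (-k)).continuous (fun t => by rw [fourier_apply, Circle.norm_coe]) hf
  rw [one_mul] at h
  exact h

/-- The functions with vanishing Fourier coefficients of negative index are closed in `L^p`. -/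
lemma fourierCoeff_eq_zero_of_tendsto {p : ℝ} [hp : Fact (1 < p)]
    {f : ℕ → Lp ℂ (ENNReal.ofReal p) (volume : Measure Torus)}
    {g : Lp ℂ (ENNReal.ofReal p) (volume : Measure Torus)} (h : Tendsto f atTop (𝓝 g)) (k : ℤ)
    (hf : ∀ n, fourierCoeff (f n) k = 0) : fourierCoeff g k = 0 := by
  have hint : ∀ a : Lp ℂ (ENNReal.ofReal p) (volume : Measure Torus),
      Integrable a AddCircle.haarAddCircle := fun a =>
    (integrable_of_memLp hp.out (Lp.memLp a)).mono_measure haarAddCircle_le_volume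
  have hle : ∀ n, ‖fourierCoeff g k‖ ≤ ‖g - f n‖ := by
    intro n
    have hadd : fourierCoeff g k = fourierCoeff (g - f n : Lp ℂ _ _) k + fourierCoeff (f n) k := by
      rw [← Pi.add_apply, ← fourierCoeff.add (hint _) (hint _),
        ← fourierCoeff_congr_ae (Lp.coeFn_add (g - f n) (f n)), sub_add_cancel]
    rw [hadd, hf n, add_zero, Lp.norm_def]
    exact norm_fourierCoeff_le (Lp.memLp _) k
  have hlim : Tendsto (fun n => ‖g - f n‖) atTop (𝓝 0) := by
    simpa using (tendsto_const_nhds (x := g)).sub h |>.norm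
  exact norm_le_zero_iff.1 (ge_of_tendsto' hlim hle)

/-! ### Completeness of the analytic Besov space -/

lemma gagliardo_le_of_tendsto_Lp {s p : ℝ} [hp : Fact (1 < p)]
    {f : ℕ → Lp ℂ (ENNReal.ofReal p) (volume : Measure Torus)}
    {g : Lp ℂ (ENNReal.ofReal p) (volume : Measure Torus)} (h : Tendsto f atTop (𝓝 g))
    {C : ℝ≥0∞} (hC : ∀ᶠ n in atTop, gagliardo s p (f n) ≤ C) : gagliardo s p g ≤ C := by
  obtain ⟨φ, hφ, hae⟩ := (tendstoInMeasure_of_tendsto_Lp h).exists_seq_tendsto_ae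
  refine (gagliardo_le_liminf hp.out (fun n => Lp.aestronglyMeasurable (f (φ n))) hae).trans ?_
  exact (liminf_le_liminf (v := fun _ => C)
    (hφ.tendsto_atTop.eventually hC)).trans_eq (liminf_const C)

lemma norm_analyticBesov {s p : ℝ} [Fact (1 < p)] (g : analyticBesov s p) :
    ‖g‖ = ‖FracSobolev.toLp (g : FracSobolev s p)‖
      + (gagliardo s p (g : FracSobolev s p)).toReal := rfl

lemma completeSpace_analyticBesov (s p : ℝ) [hp : Fact (1 < p)] :
    CompleteSpace (analyticBesov s p) := by
  refine Metric.complete_of_cauchySeq_tendsto fun f hf => ?_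
  let F : ℕ → Lp ℂ (ENNReal.ofReal p) (volume : Measure Torus) :=
    fun n => FracSobolev.toLp (f n : FracSobolev s p)
  have hnorm : ∀ n m, ‖f n - f m‖ = ‖F n - F m‖ + (gagliardo s p (F n - F m :)).toReal := by
    intro n m
    rw [norm_analyticBesov, Submodule.coe_sub, map_sub]
  have hgfin : ∀ n m, gagliardo s p (F n - F m :) < ⊤ := fun n m =>
    ((f n : FracSobolev s p) - (f m : FracSobolev s p)).2
  have hF : CauchySeq F := by
    rw [Metric.cauchySeq_iff] at hf ⊢
    intro ε hε
    obtain ⟨N, hN⟩ := hf ε hε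
    refine ⟨N, fun n hn m hm => lt_of_le_of_lt ?_ (hN n hn m hm)⟩
    rw [dist_eq_norm, dist_eq_norm, hnorm]
    exact le_add_of_nonneg_right ENNReal.toReal_nonneg
  obtain ⟨G, hG⟩ := cauchySeq_tendsto_of_complete hF
  -- The seminorm of `F n - G` is controlled by those of `F n - F m`, by Fatou's lemma.
  have key : ∀ ε > 0, ∃ N, ∀ n ≥ N, gagliardo s p (F n - G :) ≤ ENNReal.ofReal ε := by
    intro ε hε
    obtain ⟨N, hN⟩ := Metric.cauchySeq_iff.1 hf ε hε
    refine ⟨N, fun n hn => ?_⟩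
    refine gagliardo_le_of_tendsto_Lp (f := fun m => F n - F m) (tendsto_const_nhds.sub hG) ?_
    filter_upwards [eventually_ge_atTop N] with m hm
    rw [← ENNReal.ofReal_toReal (hgfin n m).ne]
    refine ENNReal.ofReal_le_ofReal ?_
    have := hN n hn m hm
    rw [dist_eq_norm, hnorm] at this
    linarith [norm_nonneg (F n - F m)]
  have hGmem : G ∈ fracSobolevSubmodule s p := by
    obtain ⟨N, hN⟩ := key 1 one_pos
    have h1 : F N - G ∈ fracSobolevSubmodule s p := (hN N le_rfl).trans_lt ENNReal.ofReal_lt_top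
    have h2 : F N ∈ fracSobolevSubmodule s p := (f N : FracSobolev s p).2
    have := Submodule.sub_mem _ h2 h1
    rwa [sub_sub_cancel] at this
  let G' : FracSobolev s p := ⟨G, hGmem⟩
  have hG' : G' ∈ analyticBesov s p := fun k hk =>
    fourierCoeff_eq_zero_of_tendsto hG k fun n => (f n).2 k hk
  refine ⟨⟨G', hG'⟩, ?_⟩
  rw [Metric.tendsto_atTop]
  intro ε hε
  obtain ⟨N, hN⟩ := key (ε / 2) (by positivity)
  obtain ⟨M, hM⟩ := Metric.tendsto_atTop.1 hG (ε / 2) (by positivity)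
  refine ⟨max N M, fun n hn => ?_⟩
  have e1 : dist (f n) ⟨G', hG'⟩ = ‖F n - G‖ + (gagliardo s p (F n - G :)).toReal := by
    rw [dist_eq_norm, norm_analyticBesov, Submodule.coe_sub, map_sub]
    rfl
  have e2 := hM n (le_of_max_le_right hn)
  rw [dist_eq_norm] at e2
  have e3 := ENNReal.toReal_mono ENNReal.ofReal_ne_top (hN n (le_of_max_le_left hn))
  rw [ENNReal.toReal_ofReal (by positivity)] at e3
  rw [e1]
  linarith

/-! ### The fractional Poincaré inequality -/

lemma poissonKernel_zero_toCircle (t : Torus) :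
    poissonKernel 0 0 (AddCircle.toCircle t : ℂ) = 1 := by
  simp [poissonKernel_def, Circle.norm_coe]

lemma poissonExtension_zero (g : Torus → ℂ) :
    poissonExtension g 0 = (2 * Real.pi : ℂ)⁻¹ * ∫ t, g t := by
  simp [poissonExtension, poissonKernel_zero_toCircle]

lemma poissonAverage_zero (g : Torus → ℂ) (θ : Torus) :
    poissonAverage 0 g θ = (2 * Real.pi : ℂ)⁻¹ * ∫ t, g t := by
  rw [two_pi_inv_mul_integral, poissonAverage, integral_poissonMeasure ⟨le_rfl, one_pos⟩,
    ← integral_add_right_eq_self g θ]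
  simp only [Complex.ofReal_zero, poissonKernel_zero_toCircle, Complex.ofReal_one, one_mul]

lemma FracSobolev.integrable_volume {s p : ℝ} [hp : Fact (1 < p)] (f : FracSobolev s p) :
    Integrable f :=
  integrable_of_memLp hp.out (Lp.memLp (FracSobolev.toLp f))

/-- The mean value is the Poisson average at the centre of the disc, so the Poincaré inequality is
the case `r = 0` of the approximation estimate. -/
lemma exists_isPoincareConst {s p : ℝ} [hp : Fact (1 < p)] (hsp : 0 < s * p) :
    ∃ κ, IsPoincareConst s p κ := by
  have hκ := kernelConst_pos s p one_pos
  refine ⟨kernelConst s p 0 ^ (1 / p), by positivity, fun f => ?_⟩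
  have h := eLpNorm_poissonAverage_sub_le hp.out hsp f.integrable_volume ⟨le_rfl, one_pos⟩
  simp only [poissonAverage_zero] at h
  refine le_of_eq_of_le ?_ h
  rw [← eLpNorm_neg]
  congr 1
  ext θ
  simp

/-! ### The Poisson extension as a linear map -/

lemma poissonExtension_congr {f g : Torus → ℂ} (h : f =ᵐ[volume] g) :
    poissonExtension f = poissonExtension g := by
  ext z
  unfold poissonExtension
  congr 1
  refine integral_congr_ae ?_
  filter_upwards [h] with t ht
  rw [ht]

lemma poissonExtension_add {f g : Torus → ℂ} (hf : Integrable f) (hg : Integrable g) :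
    poissonExtension (f + g) = poissonExtension f + poissonExtension g := by
  ext z
  simp only [poissonExtension, Pi.add_apply, mul_add]
  rw [integral_add (integrable_poissonKernel_mul hf z.norm_lt_one)
    (integrable_poissonKernel_mul hg z.norm_lt_one), mul_add]

lemma poissonExtension_smul (c : ℂ) (f : Torus → ℂ) :
    poissonExtension (c • f) = c • poissonExtension f := by
  ext z
  simp only [poissonExtension, Pi.smul_apply, smul_eq_mul, mul_left_comm _ c]
  rw [integral_const_mul, mul_left_comm]

lemma supGagliardo_poissonExtension_le {s p : ℝ} (hp : 1 < p) {g : Torus → ℂ} (hg : Integrable g) :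
    supGagliardo s p (poissonExtension g) ≤ gagliardo s p g := by
  refine iSup₂_le fun r hr => ?_
  rw [slice_poissonExtension g ⟨hr.1.le, hr.2⟩]
  exact gagliardo_poissonAverage_le hp hg ⟨hr.1.le, hr.2⟩

/-- The Poisson extension, from the analytic Besov space to the space of analytic functions. -/
def poissonMap (s p : ℝ) [hp : Fact (1 < p)] : analyticBesov s p →ₗ[ℂ] DiscSobolev s p where
  toFun g := ⟨poissonExtension (g : FracSobolev s p),
    isAnalyticOnDisc_poissonExtension (g : FracSobolev s p).integrable g.2,
    (supGagliardo_poissonExtension_le hp.out (g : FracSobolev s p).integrable_volume).trans_lt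
      (g : FracSobolev s p).gagliardo_lt_top⟩
  map_add' f g := by
    refine Subtype.ext ?_
    change poissonExtension (FracSobolev.toLp ((f + g : analyticBesov s p) : FracSobolev s p))
      = poissonExtension (f : FracSobolev s p) + poissonExtension (g : FracSobolev s p)
    rw [Submodule.coe_add, map_add, poissonExtension_congr (Lp.coeFn_add _ _),
      poissonExtension_add (f : FracSobolev s p).integrable_volume
        (g : FracSobolev s p).integrable_volume]
  map_smul' c g := by
    refine Subtype.ext ?_
    change poissonExtension (FracSobolev.toLp ((c • g : analyticBesov s p) : FracSobolev s p))
      = c • poissonExtension (g : FracSobolev s p)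
    rw [Submodule.coe_smul, map_smul, poissonExtension_congr (Lp.coeFn_smul _ _),
      poissonExtension_smul]

lemma poissonMap_apply {s p : ℝ} [Fact (1 < p)] (g : analyticBesov s p) :
    (poissonMap s p g : 𝔻 → ℂ) = poissonExtension (g : FracSobolev s p) := rfl

lemma isTrace_poissonExtension {s p : ℝ} [hp : Fact (1 < p)] (hsp : 0 < s * p)
    (g : FracSobolev s p) : IsTrace (poissonExtension g) g := by
  have h := ae_tendsto_poissonAverage hp.out hsp g.integrable_volume g.gagliardo_lt_top
  filter_upwards [h] with θ hθ
  refine hθ.congr' ?_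
  have hev : ∀ᶠ r : ℝ in 𝓝[<] 1, r ∈ Ioo (0 : ℝ) 1 := Ioo_mem_nhdsLT one_pos
  filter_upwards [hev] with r hr
  rw [slice_poissonExtension _ ⟨hr.1.le, hr.2⟩]

/-- The radial limits of the extension recover the boundary function. -/
lemma poissonMap_injective {s p : ℝ} [Fact (1 < p)] (hsp : 0 < s * p) :
    Function.Injective (poissonMap s p) := by
  rw [injective_iff_map_eq_zero]
  intro g hg
  have h := isTrace_poissonExtension hsp (g : FracSobolev s p)
  rw [← poissonMap_apply, hg, map_zero] at h
  have hae : (g : FracSobolev s p) =ᵐ[volume] (0 : Torus → ℂ) := by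
    filter_upwards [h] with θ hθ
    simp only [slice_zero, Pi.zero_apply] at hθ
    exact tendsto_nhds_unique hθ tendsto_const_nhds
  have h0 : FracSobolev.toLp (g : FracSobolev s p) = 0 := (Lp.eq_zero_iff_ae_eq_zero).2 hae
  exact Subtype.ext (Subtype.ext h0)

/-! ### Boundary values of analytic functions -/

/-- A sequence of radii increasing to `1`. -/
def radius (n : ℕ) : ℝ := 1 - 1 / (n + 2)

lemma radius_mem (n : ℕ) : radius n ∈ Ioo (0 : ℝ) 1 := by
  have h : (0 : ℝ) < n + 2 := by positivity
  have h1 : (1 : ℝ) / (n + 2) < 1 := by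
    rw [div_lt_one h]
    linarith [n.cast_nonneg (α := ℝ)]
  have h2 : (0 : ℝ) < 1 / (n + 2) := by positivity
  unfold radius
  exact ⟨by linarith, by linarith⟩

lemma radius_strictMono : StrictMono radius := by
  intro n m h
  have h' : (n : ℝ) < m := by exact_mod_cast h
  unfold radius
  gcongr

lemma tendsto_radius : Tendsto radius atTop (𝓝[<] 1) := by
  refine tendsto_nhdsWithin_iff.2 ⟨?_, Eventually.of_forall fun n => (radius_mem n).2⟩
  have h : Tendsto (fun n : ℕ => 1 / ((n : ℝ) + 2)) atTop (𝓝 0) :=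
    (tendsto_const_nhds (x := (1 : ℝ))).div_atTop
      (tendsto_atTop_add_const_right _ _ tendsto_natCast_atTop_atTop)
  have h2 := h.const_sub 1
  rw [sub_zero] at h2
  exact h2

lemma gagliardo_slice_le {s p : ℝ} (u : 𝔻 → ℂ) {r : ℝ} (hr : r ∈ Ioo (0 : ℝ) 1) :
    gagliardo s p (slice u r) ≤ supGagliardo s p u :=
  le_iSup₂ (f := fun r (_ : r ∈ Ioo (0 : ℝ) 1) => gagliardo s p (slice u r)) r hr

lemma kernelConst_le {s p r r' : ℝ} (hsp : 0 < s * p) (h : r ≤ r') (hr' : r' ≤ 1) :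
    kernelConst s p r' ≤ kernelConst s p r := by
  unfold kernelConst
  have : 0 ≤ 1 - r' := by linarith
  have ha : 0 < min (s * p) 1 := lt_min hsp one_pos
  gcongr

lemma IsAnalyticOnDisc.fourierCoeff_slice_eq_zero {u : 𝔻 → ℂ} (hu : IsAnalyticOnDisc u) {r : ℝ}
    (hr : r ∈ Ioo (0 : ℝ) 1) {k : ℤ} (hk : k < 0) : fourierCoeff (slice u r) k = 0 := by
  obtain ⟨n, rfl⟩ : ∃ n : ℕ, k = -(n : ℤ) := ⟨k.natAbs, by omega⟩
  have hn : n ≠ 0 := by omega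
  have h : DifferentiableOn ℂ (fun w => w ^ n * discExtend u (r * w))
      (closure (Metric.ball 0 1)) := by
    refine (differentiable_pow n).differentiableOn.mul
      (hu.differentiableOn.comp (by fun_prop) fun w hw => ?_)
    have hw' : ‖w‖ ≤ 1 := by
      simpa using Metric.closure_ball_subset_closedBall hw
    rw [mem_ball_zero_iff, norm_mul]
    exact (mul_le_of_le_one_right (norm_nonneg _) hw').trans_lt
      (norm_ofReal_lt_one ⟨hr.1.le, hr.2⟩)
  -- The mean value property for `w ^ n * u (r w)`, which vanishes at the origin.
  have hmean := integral_poissonKernel_mul h.diffContOnCl (z := 0) (by simp)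
  simp only [poissonKernel_zero_toCircle, Complex.ofReal_one, one_mul, zero_pow hn,
    zero_mul] at hmean
  rw [fourierCoeff_neg_eq_integral_pow]
  exact hmean

lemma tendsto_poissonExtension {p : ℝ} [hp : Fact (1 < p)]
    {f : ℕ → Lp ℂ (ENNReal.ofReal p) (volume : Measure Torus)}
    {g : Lp ℂ (ENNReal.ofReal p) (volume : Measure Torus)} (h : Tendsto f atTop (𝓝 g)) (z : 𝔻) :
    Tendsto (fun n => poissonExtension (f n) z) atTop (𝓝 (poissonExtension g z)) := by
  obtain ⟨C, hC⟩ := exists_poissonKernel_toCircle_le z.norm_lt_one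
  have hint : ∀ a : Lp ℂ (ENNReal.ofReal p) (volume : Measure Torus), Integrable a := fun a =>
    integrable_of_memLp hp.out (Lp.memLp a)
  have hle : ∀ n, ‖poissonExtension (f n) z - poissonExtension g z‖ ≤ C * ‖f n - g‖ := by
    intro n
    have hadd : poissonExtension (f n) z
        = poissonExtension (f n - g : Lp ℂ _ _) z + poissonExtension g z := by
      rw [← Pi.add_apply, ← poissonExtension_add (hint _) (hint _),
        ← poissonExtension_congr (Lp.coeFn_add (f n - g) g), sub_add_cancel]
    rw [hadd, add_sub_cancel_right, Lp.norm_def, poissonExtension_eq]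
    exact norm_integral_haar_le hp.out (Complex.continuous_ofReal.comp
      (continuous_poissonKernel_toCircle z.norm_lt_one)) hC (Lp.memLp _)
  rw [tendsto_iff_norm_sub_tendsto_zero] at h ⊢
  refine squeeze_zero (fun _ => norm_nonneg _) hle ?_
  simpa using h.const_mul C

/-- The slices of `u` are Poisson averages of each other and have bounded seminorm, so they are
Cauchy in `L^p`; the Poisson extension of their limit is `u`. -/
lemma poissonMap_surjective {s p : ℝ} [hp : Fact (1 < p)] (hsp : 0 < s * p) :
    Function.Surjective (poissonMap s p) := by
  intro u
  have hu := u.isAnalyticOnDisc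
  have hcont : ∀ n, Continuous (slice u (radius n)) := fun n => hu.continuous_slice (radius_mem n)
  have hmem : ∀ n, MemLp (slice u (radius n)) (ENNReal.ofReal p) (volume : Measure Torus) :=
    fun n => (hcont n).memLp_of_hasCompactSupport (.of_compactSpace _)
  let v : ℕ → Lp ℂ (ENNReal.ofReal p) (volume : Measure Torus) := fun n => (hmem n).toLp _
  have hv : ∀ n, v n =ᵐ[volume] slice u (radius n) := fun n => (hmem n).coeFn_toLp
  set M := (supGagliardo s p u).toReal with hM
  have hdist : ∀ n m, n ≤ m →
      dist (v n) (v m) ≤ kernelConst s p (radius n) ^ (1 / p) * M := by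
    intro n m hnm
    have hκ := kernelConst_pos s p (radius_mem n).2
    rcases hnm.eq_or_lt with rfl | hlt
    · rw [dist_self]
      exact mul_nonneg (by positivity) ENNReal.toReal_nonneg
    have hn := radius_mem n
    have hm := radius_mem m
    -- The slice at `radius n` is the Poisson average, with parameter `ρ ≥ radius n`, of the one at
    -- `radius m`.
    set ρ := radius n / radius m with hρ
    have hρ1 : ρ < 1 := (div_lt_one hm.1).2 (radius_strictMono hlt)
    have hρ0 : ρ ∈ Ico (0 : ℝ) 1 := ⟨(div_pos hn.1 hm.1).le, hρ1⟩
    have hnρ : radius n ≤ ρ := by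
      rw [hρ, le_div_iff₀ hm.1]
      exact mul_le_of_le_one_right hn.1.le hm.2.le
    have hav : slice u (radius n) = poissonAverage ρ (slice u (radius m)) := by
      rw [← hu.slice_mul ⟨hm.1.le, hm.2⟩ hρ0, hρ, mul_div_cancel₀ _ hm.1.ne']
    have h1 := eLpNorm_poissonAverage_sub_le hp.out hsp
      (integrable_of_memLp hp.out (hmem m)) hρ0
    rw [Lp.dist_def]
    have h2 : eLpNorm (v n - v m : Torus → ℂ) (ENNReal.ofReal p) (volume : Measure Torus)
        = eLpNorm (fun θ => poissonAverage ρ (slice u (radius m)) θ - slice u (radius m) θ)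
          (ENNReal.ofReal p) (volume : Measure Torus) := by
      refine eLpNorm_congr_ae ?_
      filter_upwards [hv n, hv m] with θ h1 h2
      rw [Pi.sub_apply, h1, h2, hav]
    rw [h2]
    refine (ENNReal.toReal_mono ?_ (h1.trans (mul_le_mul_right
      (gagliardo_slice_le u hm) _))).trans ?_
    · exact ENNReal.mul_ne_top ENNReal.ofReal_ne_top u.supGagliardo_lt_top.ne
    · have hκ' := kernelConst_pos s p hρ1
      rw [ENNReal.toReal_mul, ENNReal.toReal_ofReal (by positivity), ← hM]
      refine mul_le_mul_of_nonneg_right ?_ ENNReal.toReal_nonneg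
      exact Real.rpow_le_rpow hκ'.le (kernelConst_le hsp hnρ hρ1.le)
        (one_div_nonneg.2 (by linarith [hp.out]))
  have hlim : Tendsto (fun n => kernelConst s p (radius n) ^ (1 / p) * M) atTop (𝓝 0) := by
    have h1 := (tendsto_kernelConst hsp).comp (tendsto_radius.mono_right nhdsWithin_le_nhds)
    have hp0 : 0 < 1 / p := one_div_pos.2 (by linarith [hp.out])
    have h2 := (h1.rpow_const (Or.inr hp0.le)).mul_const M
    rwa [Real.zero_rpow hp0.ne', zero_mul] at h2
  obtain ⟨g, hg⟩ := cauchySeq_tendsto_of_complete (cauchySeq_of_le_tendsto_0' _ hdist hlim)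
  have hgag : gagliardo s p g ≤ supGagliardo s p u := by
    refine gagliardo_le_of_tendsto_Lp hg (Eventually.of_forall fun n => ?_)
    rw [gagliardo_congr (hv n)]
    exact gagliardo_slice_le u (radius_mem n)
  let G : FracSobolev s p := ⟨g, hgag.trans_lt u.supGagliardo_lt_top⟩
  have hG : G ∈ analyticBesov s p := fun k hk => fourierCoeff_eq_zero_of_tendsto hg k fun n => by
    rw [fourierCoeff_congr_ae (hv n)]
    exact hu.fourierCoeff_slice_eq_zero (radius_mem n) hk
  refine ⟨⟨G, hG⟩, Subtype.ext (funext fun z => ?_)⟩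
  change poissonExtension g z = u z
  have h1 := tendsto_poissonExtension hg z
  have h2 : ∀ n, poissonExtension (v n) z = discExtend u (radius n * z) := by
    intro n
    rw [poissonExtension_congr (hv n)]
    exact hu.poissonExtension_slice ⟨(radius_mem n).1.le, (radius_mem n).2⟩ z
  simp only [h2] at h1
  have hca : ContinuousAt (discExtend u) z :=
    (hu z (by simpa using z.norm_lt_one)).continuousAt
  have hr : Tendsto (fun n => (radius n : ℂ) * z) atTop (𝓝 (z : ℂ)) := by
    have := ((Complex.continuous_ofReal.tendsto 1).comp
      (tendsto_radius.mono_right nhdsWithin_le_nhds)).mul_const (z : ℂ)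
    simpa using this
  rw [tendsto_nhds_unique h1 (hca.tendsto.comp hr), discExtend_coe]

/-! ### Norm estimates -/

lemma norm_poissonMap_le {s p : ℝ} [hp : Fact (1 < p)] (g : analyticBesov s p) :
    ‖poissonMap s p g‖ ≤ ‖g‖ := by
  rw [DiscSobolev.norm_def, norm_analyticBesov, poissonMap_apply]
  refine add_le_add ?_ (ENNReal.toReal_mono (g : FracSobolev s p).gagliardo_lt_top.ne
    (supGagliardo_poissonExtension_le hp.out (g : FracSobolev s p).integrable_volume))
  rw [poissonExtension_zero, two_pi_inv_mul_integral, Lp.norm_def]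
  simpa using norm_integral_haar_le hp.out (F := fun _ => 1) (C := 1) continuous_const
    (fun _ => by simp) (Lp.memLp (FracSobolev.toLp (g : FracSobolev s p)))

/-- Fatou's lemma along the radial limits; with contractivity this makes the two seminorms
equal. -/
lemma gagliardo_le_supGagliardo_poissonExtension {s p : ℝ} [hp : Fact (1 < p)] (hsp : 0 < s * p)
    {g : FracSobolev s p} (hg : IsAnalyticOnDisc (poissonExtension g)) :
    gagliardo s p g ≤ supGagliardo s p (poissonExtension g) := by
  have h : ∀ᵐ θ : Torus,
      Tendsto (fun n => slice (poissonExtension g) (radius n) θ) atTop (𝓝 (g θ)) := by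
    filter_upwards [isTrace_poissonExtension hsp g] with θ hθ
    exact hθ.comp tendsto_radius
  refine (gagliardo_le_liminf hp.out
    (fun n => (hg.continuous_slice (radius_mem n)).aestronglyMeasurable) h).trans ?_
  exact (liminf_le_liminf (Eventually.of_forall fun n => gagliardo_slice_le _
    (radius_mem n))).trans_eq (liminf_const _)

/-- The `L^p` norm is split into the oscillation, which the Poincaré inequality controls, and the
mean value, which is the value of the extension at the origin. -/
lemma norm_le_norm_poissonMap {s p : ℝ} [hp : Fact (1 < p)] (hsp : 0 < s * p) {κ : ℝ}
    (hκ : IsPoincareConst s p κ) (g : analyticBesov s p) :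
    ‖g‖ ≤ (1 + (κ + (2 * Real.pi) ^ (1 / p))) * ‖poissonMap s p g‖ := by
  have h0 : 0 < p := by linarith [hp.out]
  set f : FracSobolev s p := g.1
  have hgag : gagliardo s p f ≤ supGagliardo s p (poissonMap s p g) :=
    gagliardo_le_supGagliardo_poissonExtension hsp
      (isAnalyticOnDisc_poissonExtension f.integrable g.2)
  have hgag' := ENNReal.toReal_mono (poissonMap s p g).supGagliardo_lt_top.ne hgag
  set c : ℂ := (2 * Real.pi : ℂ)⁻¹ * ∫ t, f t with hc
  have hc0 : (poissonMap s p g) 0 = c := by rw [poissonMap_apply, poissonExtension_zero]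
  have hLp : ‖FracSobolev.toLp f‖
      ≤ κ * (gagliardo s p f).toReal + (2 * Real.pi) ^ (1 / p) * ‖c‖ := by
    have hm : AEStronglyMeasurable (fun θ => f θ - c) (volume : Measure Torus) :=
      (Lp.aestronglyMeasurable _).sub aestronglyMeasurable_const
    have h1 := eLpNorm_add_le hm (aestronglyMeasurable_const (b := c))
      (Fact.out : 1 ≤ ENNReal.ofReal p)
    have h2 : (fun θ => f θ - c) + (fun _ => c) = (f : Torus → ℂ) := by ext θ; simp
    rw [h2, eLpNorm_const c (ENNReal.ofReal_pos.2 h0).ne'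
      (fun h => by simpa [Real.pi_pos.not_ge] using congrArg (fun μ => μ univ) h),
      AddCircle.measure_univ,
      ENNReal.toReal_ofReal h0.le, ENNReal.ofReal_rpow_of_pos Real.two_pi_pos] at h1
    have h3 := ENNReal.toReal_mono (by
      have := f.gagliardo_lt_top
      finiteness) (h1.trans (add_le_add_left (hκ.2 f) _))
    rw [ENNReal.toReal_add (by have := f.gagliardo_lt_top; finiteness) (by finiteness),
      ENNReal.toReal_mul, ENNReal.toReal_mul, ENNReal.toReal_ofReal hκ.1.le,
      ENNReal.toReal_ofReal (by positivity), toReal_enorm, mul_comm ‖c‖] at h3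
    exact h3
  rw [norm_analyticBesov, DiscSobolev.norm_def, hc0]
  have hκ0 := hκ.1
  have hpi : 0 ≤ (2 * Real.pi) ^ (1 / p) := by positivity
  have hc1 := norm_nonneg c
  have hS := ENNReal.toReal_nonneg (a := supGagliardo s p (poissonMap s p g))
  have hA := mul_le_mul_of_nonneg_left hgag' hκ0.le
  have hB := mul_nonneg hκ0.le hc1
  have hC := mul_nonneg hpi hS
  linarith

end AnalyticBesov

end

open AnalyticBesov in
theorem mainTheorem2 (s p : ℝ) [Fact (1 < p)] (hs0 : 0 < s) (hs1 : s < 1) :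
    CompleteSpace (DiscSobolev s p) ∧ CompleteSpace (analyticBesov s p) ∧
    (∃ κ : ℝ, IsPoincareConst s p κ) ∧
    ∃ T : DiscSobolev s p ≃L[ℂ] analyticBesov s p,
      (∀ u : DiscSobolev s p, IsTrace u (T u : FracSobolev s p)) ∧
      (∀ (g : analyticBesov s p) (z : Complex.UnitDisc),
        (T.symm g) z = poissonExtension (g : FracSobolev s p) z) ∧
      (∀ u : DiscSobolev s p, ‖u‖ ≤ ‖T u‖) ∧
      (∀ κ : ℝ, IsPoincareConst s p κ → ∀ u : DiscSobolev s p,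
        ‖T u‖ ≤ (1 + (κ + (2 * Real.pi) ^ (1 / p))) * ‖u‖) := by
  have hp : 1 < p := Fact.out
  have hsp : 0 < s * p := by positivity
  obtain ⟨κ, hκ⟩ := exists_isPoincareConst (s := s) (p := p) hsp
  let e : analyticBesov s p ≃ₗ[ℂ] DiscSobolev s p :=
    LinearEquiv.ofBijective (poissonMap s p) ⟨poissonMap_injective hsp, poissonMap_surjective hsp⟩
  have he : ∀ u, poissonMap s p (e.symm u) = u := e.apply_symm_apply
  let S : analyticBesov s p ≃L[ℂ] DiscSobolev s p :=
    e.toContinuousLinearEquivOfBounds 1 (1 + (κ + (2 * Real.pi) ^ (1 / p)))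
      (fun g => by rw [one_mul]; exact norm_poissonMap_le g)
      (fun u => by simpa only [he] using norm_le_norm_poissonMap hsp hκ (e.symm u))
  have hS : ∀ u, poissonMap s p (S.symm u) = u := he
  have hcomplete := completeSpace_analyticBesov s p
  refine ⟨?_, hcomplete, ⟨κ, hκ⟩, S.symm, fun u => ?_, fun g z => rfl, fun u => ?_,
    fun κ' hκ' u => ?_⟩
  · exact (completeSpace_congr (e := S.toEquiv) S.isUniformEmbedding).1 hcomplete
  · have h := isTrace_poissonExtension hsp (S.symm u : FracSobolev s p)
    rwa [← poissonMap_apply, hS] at h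
  · simpa only [hS] using norm_poissonMap_le (S.symm u)
  · simpa only [hS] using norm_le_norm_poissonMap hsp hκ' (S.symm u)
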